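/- A polynomial knot is a smooth embedding $\kappa=(x,y,z):\mathbb R\to\mathbb R^3$ whose components are polynomials, and its degree $d$ is the maximum of the degrees of $x,y,z$. Let $\bar\kappa:S^1=\mathbb R\cup\{\infty\}\to\mathbb R^3\cup\{\infty\}=S^3$ be its one-point compactification. Two knots $\alpha_0,\alpha_1:S^1\to S^3$ have the same knot type if $\alpha_0=g\circ\alpha_1\circ f$ for orientation-preserving homeomorphisms $f$ of $S^1$ and $g$ of $S^3$. The crossing number $c$ of $\kappa$ is the least number of crossings in a regular planar projection of a knot $K\subset\mathbb R^3\subset S^3$ with the same knot type as $\bar\kappa$, where a projection is regular if it has only finitely many multiple points, all of them transverse double points (the crossings). Then every polynomial knot $\kappa$ of degree $d$ has a finite crossing number $c$, and $$c\le \tfrac12(d-2)(d-3).$$ -/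

import Mathlib

open Polynomial

noncomputable section

namespace PolynomialKnots

/-- Euclidean `n`-space. -/
abbrev E (n : ℕ) : Type := EuclideanSpace ℝ (Fin n)

/-- The circle `S¹`, as the one point compactification of `ℝ`. -/
abbrev S1 : Type := OnePoint ℝ

/-- The sphere `S³`, as the one point compactification of `ℝ³`. -/
abbrev S3 : Type := OnePoint (E 3)

/-- A self-homeomorphism of (a space homeomorphic to) the `n`-sphere, `n ≥ 1`, preserves
orientation if it has degree one, i.e. acts as the identity on the `n`-th singular homology
group with integer coefficients. -/
def OrientationPreserving (n : ℕ) {X : Type} [TopologicalSpace X] (g : X ≃ₜ X) : Prop :=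
  ((AlgebraicTopology.singularHomologyFunctor AddCommGrpCat.{0} n).obj (AddCommGrpCat.of ℤ)).map
      (TopCat.ofHom (g : C(X, X))) =
    CategoryTheory.CategoryStruct.id _

/-- Topological equivalence ("same knot type") of knots `S¹ → S³`. -/
def KnotEquivalent (α₀ α₁ : S1 → S3) : Prop :=
  ∃ (f : S1 ≃ₜ S1) (g : S3 ≃ₜ S3),
    OrientationPreserving 1 f ∧ OrientationPreserving 3 g ∧ α₀ = g ∘ α₁ ∘ f

/-- The closed plane curve `γ` crosses itself transversally at the parameter values `p` and `q`:
for suitable local parametrizations `φ`, `ψ` of the circle near `p` and `q`, the two branches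
have linearly independent tangent vectors. -/
def TransverseAt (γ : S1 → E 2) (p q : S1) : Prop :=
  ∃ φ ψ : ℝ → S1, Topology.IsOpenEmbedding φ ∧ Topology.IsOpenEmbedding ψ ∧
    φ 0 = p ∧ ψ 0 = q ∧
    ∃ u v : E 2, HasDerivAt (γ ∘ φ) u 0 ∧ HasDerivAt (γ ∘ ψ) v 0 ∧
      LinearIndependent ℝ ![u, v]

/-- The multiple points of a closed plane curve. -/
def multiplePoints (γ : S1 → E 2) : Set (E 2) :=
  {x | ∃ p q : S1, p ≠ q ∧ γ p = x ∧ γ q = x}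

/-- `P ∘ K` is a regular planar projection of the knot `K` in `ℝ³`: `P` is a linear projection
onto a plane, and `P ∘ K` has only finitely many multiple points, each of which is a transverse
double point (a crossing). -/
structure RegularProjection (K : S1 → E 3) (P : E 3 →ₗ[ℝ] E 2) : Prop where
  surjective : Function.Surjective P
  finite : (multiplePoints (P ∘ K)).Finite
  double : ∀ x, {p : S1 | (P ∘ K) p = x}.encard ≤ 2
  transverse : ∀ p q : S1, p ≠ q → (P ∘ K) p = (P ∘ K) q → TransverseAt (P ∘ K) p q

/-- The crossing number of a knot `α : S¹ → S³`: the least number of crossings in a regular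
planar projection of a knot `K` in `ℝ³ ⊆ S³` of the same knot type as `α`.
It is `⊤` if there is no such projection. -/
def crossingNumber (α : S1 → S3) : ℕ∞ :=
  sInf {m | ∃ (K : S1 → E 3) (P : E 3 →ₗ[ℝ] E 2),
    Topology.IsEmbedding K ∧ KnotEquivalent (fun p ↦ ((K p : E 3) : S3)) α ∧
    RegularProjection K P ∧ m = (multiplePoints (P ∘ K)).encard}

/-- The polynomial map `ℝ → ℝⁿ` with the given components. -/
def curve {n : ℕ} (κ : Fin n → ℝ[X]) (t : ℝ) : E n :=
  WithLp.toLp 2 fun i ↦ (κ i).eval t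

/-- The polynomials `κ i` are the components of a polynomial knot, i.e. of a smooth embedding
`ℝ → ℝⁿ`: an injective immersion. (It is nonconstant, hence proper, hence automatically a
homeomorphism onto its image.) -/
structure IsPolynomialKnot {n : ℕ} (κ : Fin n → ℝ[X]) : Prop where
  injective : Function.Injective (curve κ)
  immersion : ∀ t, deriv (curve κ) t ≠ 0

/-- The degree of a polynomial map: the maximal degree of its components. -/
def degree {n : ℕ} (κ : Fin n → ℝ[X]) : ℕ :=
  Finset.univ.sup fun i ↦ (κ i).natDegree

/-- The one point compactification `S¹ → S³` of a polynomial map `ℝ → ℝ³`. -/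
def completion (κ : Fin 3 → ℝ[X]) : S1 → S3 :=
  OnePoint.map (curve κ)

end PolynomialKnots

end

noncomputable section

namespace PolynomialKnots

open Filter Topology

/-! ### Orientation preserving homeomorphisms -/

section Orientation

variable {n : ℕ} {X Y : Type} [TopologicalSpace X] [TopologicalSpace Y]

/-! The bound is Bézout's theorem applied to a vertical projection. Shears and a rotation, all
ambient isotopies, bring the knot to a form with `deg x ≤ d - 2`, `deg y ≤ d - 1` and `z`
nonconstant with positive leading coefficient (`IsKnotCurve.exists_normal_form`). A double point of
the plane curve `(x, y)` is a pair `s ≠ t` at which the divided differences of `x` and of `y` both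
vanish. These have total degrees at most `d - 3` and `d - 2` in `(s, t)`, so eliminating `t` by a
resultant leaves a polynomial in `s` of degree at most `(d - 3)(d - 2)`. Each crossing uses two of
its roots, whence the factor `1/2`.

Three points need care. The projection must be regular and the resultant nonzero: adding small terms
`a t + b t ^ 2` to `x` and `y` achieves both, since the bad parameters are a null set, by a Sard and
dimension argument, and nonvanishing of the resultant is an open condition met arbitrarily near zero
(`exists_generic_perturb`).

The perturbation, although unbounded at the ends, must not change the knot type: a height-dependent
affine motion of the horizontal plane makes the ends vertical, after which the two curves differ by
a Lipschitz-small displacement, and this extends to a homeomorphism of space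
(`eventually_ambientIsotopic_perturb`).

The knot passes through infinity, whereas crossings are counted for knots in `ℝ³`: after translating
a point off the plane curve to `0` and compressing vertically, a homeomorphism of the sphere
covering `w ↦ w⁻¹` takes infinity to the origin and creates no crossing (`exists_inversion`,
`crossingNumber_le_of_isRegularPlaneCurve`).

For `d ≤ 3` the quadratic perturbation would raise the degree; there `x` has degree at most one and
a projection without crossings exists. -/

theorem OrientationPreserving.refl : OrientationPreserving n (Homeomorph.refl X) :=
  CategoryTheory.Functor.map_id _ _

theorem OrientationPreserving.trans {g h : X ≃ₜ X} (hg : OrientationPreserving n g)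
    (hh : OrientationPreserving n h) : OrientationPreserving n (g.trans h) := by
  unfold OrientationPreserving at *
  have : TopCat.ofHom ((g.trans h : X ≃ₜ X) : C(X, X)) =
      CategoryTheory.CategoryStruct.comp (TopCat.ofHom (g : C(X, X)))
        (TopCat.ofHom (h : C(X, X))) := rfl
  rw [this, CategoryTheory.Functor.map_comp, hg, hh, CategoryTheory.Category.comp_id]

theorem OrientationPreserving.symm {g : X ≃ₜ X} (hg : OrientationPreserving n g) :
    OrientationPreserving n g.symm := by
  have h := OrientationPreserving.refl (n := n) (X := X)
  rw [← Homeomorph.self_trans_symm g] at h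
  unfold OrientationPreserving at *
  have e : TopCat.ofHom ((g.trans g.symm : X ≃ₜ X) : C(X, X)) =
      CategoryTheory.CategoryStruct.comp (TopCat.ofHom (g : C(X, X)))
        (TopCat.ofHom (g.symm : C(X, X))) := rfl
  rwa [e, CategoryTheory.Functor.map_comp, hg, CategoryTheory.Category.id_comp] at h

/-- By functoriality the homology maps of `c` and of its inverse cancel, so `c` itself needs no
orientation. -/
theorem OrientationPreserving.conj {g : Y ≃ₜ Y} (hg : OrientationPreserving n g) (c : X ≃ₜ Y) :
    OrientationPreserving n ((c.trans g).trans c.symm) := by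
  have h := OrientationPreserving.refl (n := n) (X := X)
  rw [← Homeomorph.self_trans_symm c] at h
  unfold OrientationPreserving at *
  have e : TopCat.ofHom (((c.trans g).trans c.symm : X ≃ₜ X) : C(X, X)) =
      CategoryTheory.CategoryStruct.comp (TopCat.ofHom (c : C(X, Y)))
        (CategoryTheory.CategoryStruct.comp (TopCat.ofHom (g : C(Y, Y)))
        (TopCat.ofHom (c.symm : C(Y, X)))) := rfl
  have e' : TopCat.ofHom ((c.trans c.symm : X ≃ₜ X) : C(X, X)) =
      CategoryTheory.CategoryStruct.comp (TopCat.ofHom (c : C(X, Y)))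
        (TopCat.ofHom (c.symm : C(Y, X))) := rfl
  rw [e', CategoryTheory.Functor.map_comp] at h
  rw [e, CategoryTheory.Functor.map_comp, CategoryTheory.Functor.map_comp, hg,
    CategoryTheory.Category.id_comp, h]

/-- Homotopy invariance of singular homology. Every orientation check below deforms the identity in
this way, up to composition and conjugation. -/
theorem OrientationPreserving.of_homotopy {g h : X ≃ₜ X} (hg : OrientationPreserving n g)
    (H : unitInterval × X → X) (hH : Continuous H) (h0 : ∀ x, H (0, x) = g x)
    (h1 : ∀ x, H (1, x) = h x) : OrientationPreserving n h := by
  unfold OrientationPreserving at *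
  rw [← hg]
  let F : TopCat.Homotopy (TopCat.ofHom (h : C(X, X))) (TopCat.ofHom (g : C(X, X))) :=
    ContinuousMap.Homotopy.symm
      { toContinuousMap := ⟨H, hH⟩
        map_zero_left := h0
        map_one_left := h1 }
  exact F.congr_homologyMap_singularChainComplexFunctor _ n

end Orientation

/-! ### Ambient isotopies of `ℂ × ℝ` -/

/-- Three-space, as the product of a complex plane and a vertical line. -/
abbrev V : Type := ℂ × ℝ

/-- The identification of Euclidean three-space with `ℂ × ℝ`. -/
def coords : E 3 ≃ₜ V where
  toFun v := (⟨v 0, v 1⟩, v 2)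
  invFun w := WithLp.toLp 2 ![w.1.re, w.1.im, w.2]
  left_inv v := by ext i; fin_cases i <;> rfl
  right_inv w := rfl
  continuous_toFun := by
    have : (fun v : E 3 ↦ ((⟨v 0, v 1⟩ : ℂ), v 2)) =
        fun v : E 3 ↦ (((v 0 : ℝ) : ℂ) + ((v 1 : ℝ) : ℂ) * Complex.I, v 2) := by
      ext v
      · exact Complex.mk_eq_add_mul_I _ _
      · rfl
    rw [this]
    fun_prop
  continuous_invFun := by
    refine (PiLp.continuous_toLp 2 _).comp (continuous_pi fun i ↦ ?_)
    fin_cases i <;> simp <;> fun_prop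

/-- The homeomorphism of `S³` induced by a homeomorphism of `ℂ × ℝ`. -/
def extend (h : V ≃ₜ V) : S3 ≃ₜ S3 :=
  (coords.onePointCongr.trans h.onePointCongr).trans coords.onePointCongr.symm

theorem extend_coe (h : V ≃ₜ V) (v : V) :
    extend h ((coords.symm v : E 3) : S3) = ((coords.symm (h v) : E 3) : S3) := by
  simp [extend]

theorem extend_infty (h : V ≃ₜ V) : extend h OnePoint.infty = OnePoint.infty := rfl

/-- A homotopy through proper maps from `g` to `h`. -/
def ProperlyHomotopic (g h : V ≃ₜ V) : Prop :=
  ∃ H : ℝ × V → V, ContinuousOn H (Set.Icc 0 1 ×ˢ Set.univ) ∧ (∀ v, H (0, v) = g v) ∧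
    (∀ v, H (1, v) = h v) ∧ ∀ r, ∃ R, ∀ s ∈ Set.Icc (0 : ℝ) 1, ∀ v, ‖H (s, v)‖ ≤ r → ‖v‖ ≤ R

/-- Properness uniform in the time parameter is what joint continuity at infinity requires: outside
one ball of radius `R`, all the maps avoid a given compact set at once. -/
theorem continuous_onePoint_homotopy (H : unitInterval × V → V) (hH : Continuous H)
    (hp : ∀ r, ∃ R, ∀ s v, ‖H (s, v)‖ ≤ r → ‖v‖ ≤ R) :
    Continuous fun p : unitInterval × OnePoint V ↦ OnePoint.map (fun v ↦ H (p.1, v)) p.2 := by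
  rw [continuous_iff_continuousAt]
  rintro ⟨s, v⟩
  induction v using OnePoint.rec with
  | infty =>
    rw [ContinuousAt, OnePoint.map_infty, OnePoint.hasBasis_nhds_infty.tendsto_right_iff]
    rintro C ⟨-, hC⟩
    obtain ⟨r, hr⟩ := hC.isBounded.subset_closedBall 0
    obtain ⟨R, hR⟩ := hp r
    have : (Set.univ : Set unitInterval) ×ˢ ((↑) '' Metric.closedBall (0 : V) R : Set (OnePoint V))ᶜ
        ∈ 𝓝 (s, (OnePoint.infty : OnePoint V)) := by
      refine prod_mem_nhds univ_mem (IsOpen.mem_nhds ?_ ?_)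
      · rw [OnePoint.isOpen_compl_image_coe]
        exact ⟨Metric.isClosed_closedBall, isCompact_closedBall 0 R⟩
      · simp
    filter_upwards [this]
    rintro ⟨s', w⟩ ⟨-, hw⟩
    induction w using OnePoint.rec with
    | infty => simp
    | coe w =>
      left
      refine ⟨_, ?_, rfl⟩
      intro hmem
      apply hw
      refine ⟨w, ?_, rfl⟩
      have := hr hmem
      simp only [mem_closedBall_zero_iff] at this ⊢
      exact hR _ _ this
  | coe v =>
    have ho : IsOpenEmbedding (Prod.map (id : unitInterval → unitInterval)
        ((↑) : V → OnePoint V)) :=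
      IsOpenEmbedding.id.prodMap OnePoint.isOpenEmbedding_coe
    change ContinuousAt _ (Prod.map (id : unitInterval → unitInterval)
        ((↑) : V → OnePoint V) (s, v))
    rw [← ho.continuousAt_iff]
    have : Continuous fun p : unitInterval × V ↦ ((H p : V) : OnePoint V) :=
      OnePoint.continuous_coe.comp hH
    exact this.continuousAt

theorem OrientationPreserving.extend_of_properlyHomotopic {n : ℕ} {g h : V ≃ₜ V}
    (H : ProperlyHomotopic g h) (hg : OrientationPreserving n (extend g)) :
    OrientationPreserving n (extend h) := by
  obtain ⟨H, hc, h0, h1, hp⟩ := H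
  set H' : unitInterval × V → V := fun p ↦ H (p.1, p.2) with hH'
  have hc' : Continuous H' := by
    refine hc.comp_continuous (by fun_prop) ?_
    rintro ⟨s, v⟩
    exact ⟨s.2, trivial⟩
  have hcont := continuous_onePoint_homotopy H' hc' fun r ↦ by
    obtain ⟨R, hR⟩ := hp r
    exact ⟨R, fun s v ↦ hR s s.2 v⟩
  refine hg.of_homotopy (fun p ↦ coords.onePointCongr.symm
    (OnePoint.map (fun v ↦ H' (p.1, v)) (coords.onePointCongr p.2))) ?_ ?_ ?_
  · exact coords.onePointCongr.symm.continuous.comp (hcont.comp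
      (continuous_fst.prodMk (coords.onePointCongr.continuous.comp continuous_snd)))
  · intro x
    have : (fun v ↦ H' (0, v)) = g := by ext1 v; simp [hH', h0]
    simp only [this]
    rfl
  · intro x
    have : (fun v ↦ H' (1, v)) = h := by ext1 v; simp [hH', h1]
    simp only [this]
    rfl

theorem orientationPreserving_extend {h : V ≃ₜ V} (H : ProperlyHomotopic (Homeomorph.refl V) h) :
    OrientationPreserving 3 (extend h) := by
  refine OrientationPreserving.extend_of_properlyHomotopic H ?_
  convert OrientationPreserving.refl (n := 3) (X := S3)
  ext x
  induction x using OnePoint.rec with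
  | infty => rfl
  | coe x => simp [extend]

/-- A jointly continuous family of left inverses gives uniform properness: the points sent into a
ball lie in the `G`-image of the compact set `[0, 1] × ball`. -/
theorem ProperlyHomotopic.of_inverse {g h : V ≃ₜ V} (H G : ℝ × V → V) (hH : Continuous H)
    (hG : Continuous G) (hGH : ∀ s ∈ Set.Icc (0 : ℝ) 1, ∀ v, G (s, H (s, v)) = v)
    (h0 : ∀ v, H (0, v) = g v) (h1 : ∀ v, H (1, v) = h v) : ProperlyHomotopic g h := by
  refine ⟨H, hH.continuousOn, h0, h1, fun r ↦ ?_⟩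
  obtain ⟨R, hR⟩ := ((isCompact_Icc.prod (isCompact_closedBall (0 : V) r)).image hG)
    |>.isBounded.subset_closedBall 0
  refine ⟨R, fun s hs v hv ↦ ?_⟩
  have := hR ⟨(s, H (s, v)), ⟨hs, by simpa using hv⟩, rfl⟩
  rwa [hGH s hs, mem_closedBall_zero_iff] at this

/-- Two properly embedded curves in `ℂ × ℝ` correspond to each other under an orientation
preserving homeomorphism of `S³` fixing infinity. -/
def AmbientIsotopic (k k' : ℝ → V) : Prop :=
  ∃ g : S3 ≃ₜ S3, OrientationPreserving 3 g ∧ g OnePoint.infty = OnePoint.infty ∧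
    ∀ t, g ((coords.symm (k t) : E 3) : S3) = ((coords.symm (k' t) : E 3) : S3)

theorem AmbientIsotopic.trans {k k' k'' : ℝ → V} (h : AmbientIsotopic k k')
    (h' : AmbientIsotopic k' k'') : AmbientIsotopic k k'' := by
  obtain ⟨g, h1, h2, h3⟩ := h
  obtain ⟨g', h1', h2', h3'⟩ := h'
  exact ⟨g.trans g', h1.trans h1', by simp [h2, h2'], fun t ↦ by simp [h3, h3']⟩

theorem AmbientIsotopic.symm {k k' : ℝ → V} (h : AmbientIsotopic k k') :
    AmbientIsotopic k' k := by
  obtain ⟨g, h1, h2, h3⟩ := h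
  exact ⟨g.symm, h1.symm, by rw [Homeomorph.symm_apply_eq, h2],
    fun t ↦ by rw [Homeomorph.symm_apply_eq, h3]⟩

theorem AmbientIsotopic.injective {k k' : ℝ → V} (h : AmbientIsotopic k k')
    (hk : Function.Injective k) : Function.Injective k' := by
  obtain ⟨g, -, -, h3⟩ := h
  intro s t hst
  have := (h3 s).trans ((congrArg (fun v ↦ ((coords.symm v : E 3) : S3)) hst).trans (h3 t).symm)
  exact hk (coords.symm.injective (OnePoint.coe_injective (g.injective this)))

theorem AmbientIsotopic.of_homeomorph {k : ℝ → V} (h : V ≃ₜ V)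
    (H : ProperlyHomotopic (Homeomorph.refl V) h) : AmbientIsotopic k (h ∘ k) :=
  ⟨extend h, orientationPreserving_extend H, extend_infty h, fun _ ↦ extend_coe h _⟩

/-! ### Elementary ambient isotopies -/

theorem AmbientIsotopic.translate (k : ℝ → V) {c : ℝ → ℂ} (hc : Continuous c) :
    AmbientIsotopic k fun t ↦ ((k t).1 - c (k t).2, (k t).2) := by
  let h : V ≃ₜ V :=
    { toFun := fun v ↦ (v.1 - c v.2, v.2)
      invFun := fun v ↦ (v.1 + c v.2, v.2)
      left_inv := fun v ↦ by simp
      right_inv := fun v ↦ by simp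
      continuous_toFun := by fun_prop
      continuous_invFun := by fun_prop }
  exact AmbientIsotopic.of_homeomorph h <| .of_inverse
    (fun p ↦ (p.2.1 - p.1 * c p.2.2, p.2.2)) (fun p ↦ (p.2.1 + p.1 * c p.2.2, p.2.2))
    (by fun_prop) (by fun_prop) (by simp) (by simp) (by simp [h])

/-- The path `exp (s * log u)` joins `1` to `u` inside the nonzero complex numbers. -/
theorem AmbientIsotopic.mul_const (k : ℝ → V) {u : ℂ} (hu : u ≠ 0) :
    AmbientIsotopic k fun t ↦ ((k t).1 * u, (k t).2) := by
  let h : V ≃ₜ V :=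
    { toFun := fun v ↦ (v.1 * u, v.2)
      invFun := fun v ↦ (v.1 * u⁻¹, v.2)
      left_inv := fun v ↦ by simp [hu]
      right_inv := fun v ↦ by simp [hu]
      continuous_toFun := by fun_prop
      continuous_invFun := by fun_prop }
  refine AmbientIsotopic.of_homeomorph h <| .of_inverse
    (fun p ↦ (p.2.1 * Complex.exp (p.1 * Complex.log u), p.2.2))
    (fun p ↦ (p.2.1 * Complex.exp (-(p.1 * Complex.log u)), p.2.2))
    (by fun_prop) (by fun_prop) ?_ (by simp) (by simp [h, Complex.exp_log hu])
  intro s _ v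
  simp [mul_assoc, ← Complex.exp_add]

/-- After division by `u 0`, the multiplier is deformed to `1` by shrinking its argument: `u (s * z)
/ u 0` never vanishes. The remaining constant `u 0` is treated separately. -/
theorem AmbientIsotopic.mul (k : ℝ → V) {u : ℝ → ℂ} (huc : Continuous u) (hu : ∀ z, u z ≠ 0) :
    AmbientIsotopic k fun t ↦ ((k t).1 * u (k t).2, (k t).2) := by
  let h : V ≃ₜ V :=
    { toFun := fun v ↦ (v.1 * (u v.2 / u 0), v.2)
      invFun := fun v ↦ (v.1 * (u v.2 / u 0)⁻¹, v.2)
      left_inv := fun v ↦ by ext1 <;> field_simp [hu]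
      right_inv := fun v ↦ by ext1 <;> field_simp [hu]
      continuous_toFun := by fun_prop
      continuous_invFun := by fun_prop (disch := simp [hu]) }
  have key : AmbientIsotopic k (h ∘ k) := by
    refine AmbientIsotopic.of_homeomorph h <| .of_inverse
      (fun p ↦ (p.2.1 * (u (p.1 * p.2.2) / u 0), p.2.2))
      (fun p ↦ (p.2.1 * (u (p.1 * p.2.2) / u 0)⁻¹, p.2.2))
      (by fun_prop) ?_ ?_ (by simp [hu]) (by simp [h])
    · fun_prop (disch := simp [hu])
    · intro s _ v
      ext1 <;> field_simp [hu]
  have := key.trans (AmbientIsotopic.mul_const _ (hu 0))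
  convert this using 3 with t
  · simp [h, mul_assoc, hu]
  · rfl

/-- The linear interpolation from `1` to `μ` stays positive only for `s` in `[0, 1]`, so the inverse
family is continuous only there and properness is derived from compactness of `[0, 1] × ball`
directly. -/
theorem AmbientIsotopic.vertical (k : ℝ → V) {μ ν : ℂ → ℝ} (hμ : Continuous μ)
    (hν : Continuous ν) (hpos : ∀ x, 0 < μ x) :
    AmbientIsotopic k fun t ↦ ((k t).1, (k t).2 * μ (k t).1 + ν (k t).1) := by
  have hne : ∀ x, μ x ≠ 0 := fun x ↦ (hpos x).ne'
  let h : V ≃ₜ V :=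
    { toFun := fun v ↦ (v.1, v.2 * μ v.1 + ν v.1)
      invFun := fun v ↦ (v.1, (v.2 - ν v.1) * (μ v.1)⁻¹)
      left_inv := fun v ↦ by simp [hne]
      right_inv := fun v ↦ by simp [hne]
      continuous_toFun := by fun_prop
      continuous_invFun := by fun_prop (disch := simp [hne]) }
  have hd : ∀ s ∈ Set.Icc (0 : ℝ) 1, ∀ x, 0 < 1 - s + s * μ x := by
    rintro s ⟨h0, h1⟩ x
    rcases h0.eq_or_lt with rfl | h0
    · simp
    · have := mul_pos h0 (hpos x)
      linarith
  refine AmbientIsotopic.of_homeomorph h ⟨fun p ↦ (p.2.1, p.2.2 * (1 - p.1 + p.1 * μ p.2.1) +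
      p.1 * ν p.2.1), Continuous.continuousOn (by fun_prop), by simp, by simp [h], fun r ↦ ?_⟩
  have hcont : ContinuousOn (fun p : ℝ × V ↦ ((p.2.1,
      (p.2.2 - p.1 * ν p.2.1) / (1 - p.1 + p.1 * μ p.2.1)) : V))
      (Set.Icc (0 : ℝ) 1 ×ˢ Metric.closedBall (0 : V) r) := by
    refine ContinuousOn.prodMk (by fun_prop) (ContinuousOn.div (by fun_prop) (by fun_prop) ?_)
    rintro ⟨s, v⟩ ⟨hs, -⟩
    exact (hd s hs _).ne'
  obtain ⟨R, hR⟩ := ((isCompact_Icc.prod (isCompact_closedBall (0 : V) r)).image_of_continuousOn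
    hcont).isBounded.subset_closedBall 0
  refine ⟨R, fun s hs v hv ↦ ?_⟩
  have := hR ⟨(s, (v.1, v.2 * (1 - s + s * μ v.1) + s * ν v.1)), ⟨hs, by simpa using hv⟩, rfl⟩
  have e := (hd s hs v.1).ne'
  simpa [e] using this

/-- The displacement `k' - k`, seen as a function on the image of `k`, extends to all of space with
Lipschitz constant at most `1/2`. The identity plus such a map is a homeomorphism, and scaling the
displacement by `s` is a proper homotopy from the identity. The value `ε = 1 / (2L)` absorbs the
constant `L` lost in the extension. -/
theorem AmbientIsotopic.of_lipschitz :
    ∃ ε : ℝ, 0 < ε ∧ ∀ k k' : ℝ → V,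
      (∀ s t, ‖(k' s - k s) - (k' t - k t)‖ ≤ ε * ‖k s - k t‖) → AmbientIsotopic k k' := by
  set L := lipschitzExtensionConstant V with hL
  have hLpos : 0 < L := lipschitzExtensionConstant_pos V
  refine ⟨((2 * L)⁻¹ : NNReal), by positivity, fun k k' hk ↦ ?_⟩
  -- The choice of parameter is harmless: if `k s = k t`, the hypothesis forces equal displacements
  -- at `s` and `t`.
  choose! τ hτ using fun (v : V) (hv : v ∈ Set.range k) ↦ hv
  set w : V → V := fun v ↦ k' (τ v) - v with hw
  have hwk : ∀ t, w (k t) = k' t - k t := by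
    intro t
    have h1 := hτ (k t) ⟨t, rfl⟩
    have h2 := hk (τ (k t)) t
    rw [h1, sub_self, norm_zero, mul_zero, norm_le_zero_iff, sub_eq_zero] at h2
    exact h2
  have hlip : LipschitzOnWith (2 * L)⁻¹ w (Set.range k) := by
    refine LipschitzOnWith.of_dist_le_mul ?_
    rintro _ ⟨s, rfl⟩ _ ⟨t, rfl⟩
    rw [hwk, hwk, dist_eq_norm, dist_eq_norm]
    exact hk s t
  obtain ⟨W, hW, hWw⟩ := hlip.extend_finite_dimension
  have hc : lipschitzExtensionConstant V * (2 * L)⁻¹ = 1 / 2 := by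
    rw [← hL]; field_simp
  rw [hc] at hW
  have happ : ApproximatesLinearOn (fun v ↦ v + W v)
      ((ContinuousLinearEquiv.refl ℝ V : V ≃L[ℝ] V) : V →L[ℝ] V) Set.univ (1 / 2) := by
    intro x _ y _
    have := hW.dist_le_mul x y
    rw [dist_eq_norm, dist_eq_norm] at this
    have e : x + W x - (y + W y) - (x - y) = W x - W y := by abel
    change ‖x + W x - (y + W y) - (x - y)‖ ≤ _
    rw [e]
    exact this
  have hN : (1 / 2 : NNReal) <
      ‖(((ContinuousLinearEquiv.refl ℝ V).symm : V ≃L[ℝ] V) : V →L[ℝ] V)‖₊⁻¹ := by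
    have : ‖(((ContinuousLinearEquiv.refl ℝ V).symm : V ≃L[ℝ] V) : V →L[ℝ] V)‖₊ = 1 := by
      ext
      exact ContinuousLinearMap.norm_id
    rw [this, inv_one]
    exact NNReal.half_lt_self one_ne_zero
  let h : V ≃ₜ V := happ.toHomeomorph _ (Or.inr hN)
  have hh : ∀ v, h v = v + W v := fun v ↦ rfl
  have : AmbientIsotopic k (h ∘ k) := by
    have hWc := hW.continuous
    refine AmbientIsotopic.of_homeomorph h ⟨fun p ↦ p.2 + p.1 • W p.2,
      Continuous.continuousOn (by fun_prop), by simp, by simp [hh], fun r ↦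
        ⟨2 * (r + ‖W 0‖), fun s hs v hv ↦ ?_⟩⟩
    have h1 := hW.dist_le_mul v 0
    rw [dist_eq_norm, dist_eq_norm, sub_zero] at h1
    have h2 : ‖v‖ ≤ ‖v + s • W v‖ + ‖s • W v‖ := by
      simpa using norm_sub_le (v + s • W v) (s • W v)
    have h3 : ‖s • W v‖ ≤ ‖W v‖ := by
      rw [norm_smul, Real.norm_of_nonneg hs.1]
      exact mul_le_of_le_one_left (norm_nonneg _) hs.2
    have h4 : ‖W v‖ ≤ ‖W v - W 0‖ + ‖W 0‖ := by
      simpa using norm_add_le (W v - W 0) (W 0)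
    have h5 : ((1 / 2 : NNReal) : ℝ) = 1 / 2 := by simp
    rw [h5] at h1
    linarith
  convert this using 1
  ext1 t
  rw [Function.comp_apply, hh, ← hWw ⟨t, rfl⟩, hwk]
  abel

end PolynomialKnots

end

noncomputable section

namespace PolynomialKnots

open Filter Topology

/-! ### Moving infinity to the origin -/

/-- The square of the Euclidean norm on `ℂ × ℝ`. -/
def sqNorm (v : V) : ℝ := Complex.normSq v.1 + v.2 ^ 2

@[fun_prop]
theorem continuous_sqNorm : Continuous sqNorm := by
  have := Complex.continuous_normSq
  unfold sqNorm
  fun_prop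

theorem sqNorm_nonneg (v : V) : 0 ≤ sqNorm v := add_nonneg (Complex.normSq_nonneg _) (sq_nonneg _)

theorem sqNorm_smul (c : ℝ) (v : V) : sqNorm (c • v) = c ^ 2 * sqNorm v := by
  simp [sqNorm, Complex.normSq_apply]
  ring

theorem norm_sq_le_sqNorm (v : V) : ‖v‖ ^ 2 ≤ sqNorm v := by
  rw [Prod.norm_def]
  rcases max_choice ‖v.1‖ ‖v.2‖ with h | h <;> rw [h]
  · rw [Complex.sq_norm]
    exact le_add_of_nonneg_right (sq_nonneg _)
  · rw [Real.norm_eq_abs, sq_abs]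
    exact le_add_of_nonneg_left (Complex.normSq_nonneg _)

theorem sqNorm_eq_zero {v : V} : sqNorm v = 0 ↔ v = 0 := by
  constructor
  · intro h
    have := norm_sq_le_sqNorm v
    rw [h] at this
    exact norm_eq_zero.1 (pow_eq_zero_iff two_ne_zero |>.1 (le_antisymm this (sq_nonneg _)))
  · rintro rfl
    simp [sqNorm]

theorem sqNorm_pos {v : V} (hv : v ≠ 0) : 0 < sqNorm v :=
  (sqNorm_nonneg v).lt_of_ne' fun h ↦ hv (sqNorm_eq_zero.1 h)

/-- The unit sphere in `ℂ × ℝ × ℝ`. -/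
abbrev UnitSphere : Type := {p : V × ℝ // sqNorm p.1 + p.2 ^ 2 = 1}

/-- Inverse stereographic projection. -/
def stereoFun : OnePoint V → UnitSphere :=
  fun p ↦ p.elim ⟨(0, 1), by simp [sqNorm]⟩ fun v ↦
    ⟨((2 / (sqNorm v + 1)) • v, (sqNorm v - 1) / (sqNorm v + 1)), by
      have := sqNorm_nonneg v
      rw [sqNorm_smul]
      field_simp
      ring⟩

theorem stereoFun_infty : (stereoFun OnePoint.infty).1 = (0, 1) := rfl

theorem stereoFun_coe (v : V) : (stereoFun v).1 =
    ((2 / (sqNorm v + 1)) • v, (sqNorm v - 1) / (sqNorm v + 1)) := rfl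

theorem continuous_stereoFun : Continuous stereoFun := by
  have hne : ∀ v, sqNorm v + 1 ≠ 0 := fun v ↦ by have := sqNorm_nonneg v; positivity
  rw [OnePoint.continuous_iff]
  constructor
  · rw [coclosedCompact_eq_cocompact, tendsto_subtype_rng]
    have hN : Tendsto sqNorm (cocompact V) atTop :=
      tendsto_atTop_mono norm_sq_le_sqNorm
        ((tendsto_pow_atTop two_ne_zero).comp tendsto_norm_cocompact_atTop)
    refine Tendsto.prodMk_nhds (x := (0 : V)) (y := (1 : ℝ)) ?_ ?_
    · refine squeeze_zero_norm (a := fun v ↦ 2 / ‖v‖) (fun v ↦ ?_)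
        (tendsto_const_nhds.div_atTop tendsto_norm_cocompact_atTop)
      have h1 := norm_sq_le_sqNorm v
      have h2 := sqNorm_nonneg v
      rcases eq_or_ne v 0 with rfl | hv
      · simp
      have h3 : 0 < ‖v‖ := norm_pos_iff.2 hv
      change ‖(2 / (sqNorm v + 1)) • v‖ ≤ _
      rw [norm_smul, Real.norm_of_nonneg (by positivity), div_mul_eq_mul_div,
        div_le_div_iff₀ (by positivity) h3]
      nlinarith
    · have : ∀ v : V, (sqNorm v - 1) / (sqNorm v + 1) = 1 - 2 / (sqNorm v + 1) := fun v ↦ by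
        have := hne v
        field_simp
        ring
      change Tendsto (fun v ↦ (sqNorm v - 1) / (sqNorm v + 1)) _ _
      simp_rw [this]
      simpa using (tendsto_const_nhds (x := (1 : ℝ))).sub
        ((tendsto_const_nhds (x := (2 : ℝ))).div_atTop (tendsto_atTop_add_const_right _ 1 hN))
  · refine Continuous.subtype_mk ?_ _
    fun_prop (disch := exact hne _)

/-- The inverse of the stereographic projection, as a homeomorphism. -/
def stereo : OnePoint V ≃ₜ UnitSphere :=
  Continuous.homeoOfEquivCompactToT2
    (f :=
      { toFun := stereoFun
        invFun := fun p ↦ if p.1.2 = 1 then OnePoint.infty else ((1 - p.1.2)⁻¹ • p.1.1 : V)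
        left_inv := by
          intro p
          induction p using OnePoint.rec with
          | infty => simp [stereoFun]
          | coe v =>
            have h := sqNorm_nonneg v
            have h1 : (sqNorm v - 1) / (sqNorm v + 1) ≠ 1 := by
              rw [Ne, div_eq_one_iff_eq (by positivity)]
              linarith
            have h2 : (1 - (sqNorm v - 1) / (sqNorm v + 1))⁻¹ * (2 / (sqNorm v + 1)) = 1 := by
              have : 1 - (sqNorm v - 1) / (sqNorm v + 1) = 2 / (sqNorm v + 1) := by
                field_simp
                ring
              rw [this]
              exact inv_mul_cancel₀ (by positivity)
            simp only [stereoFun, OnePoint.elim_some, h1, if_false, smul_smul, h2, one_smul]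
        right_inv := by
          rintro ⟨⟨w, h⟩, hp⟩
          simp only at hp
          by_cases h1 : h = 1
          · subst h1
            have : w = 0 := sqNorm_eq_zero.1 (by linarith)
            subst this
            simp [stereoFun]
          · have h2 : 1 - h ≠ 0 := sub_ne_zero.2 (Ne.symm h1)
            have hN : sqNorm ((1 - h)⁻¹ • w) = (1 + h) / (1 - h) := by
              rw [sqNorm_smul, show sqNorm w = (1 - h) * (1 + h) by linarith]
              field_simp
            have h3 : (1 + h) / (1 - h) + 1 = 2 / (1 - h) := by field_simp; ring
            simp only [h1, if_false, stereoFun, OnePoint.elim_some, hN, h3, smul_smul]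
            ext1
            ext1
            · simp only
              rw [div_div_cancel₀ two_ne_zero, mul_inv_cancel₀ h2, one_smul]
            · simp only
              field_simp
              ring })
    continuous_stereoFun

theorem stereo_apply (p : OnePoint V) : stereo p = stereoFun p := rfl

/-- The rotation of the sphere by the angle `θ` in the plane spanned by the imaginary axis
and the last coordinate axis. -/
def rotateFun (θ : ℝ) (p : UnitSphere) : UnitSphere :=
  ⟨((⟨p.1.1.1.re, Real.cos θ * p.1.1.1.im - Real.sin θ * p.1.2⟩, p.1.1.2),
    Real.sin θ * p.1.1.1.im + Real.cos θ * p.1.2), by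
      have h := p.2
      simp only [sqNorm, Complex.normSq_apply] at h ⊢
      linear_combination h +
        (p.1.1.1.im ^ 2 + p.1.2 ^ 2) * Real.sin_sq_add_cos_sq θ⟩

theorem continuous_rotateFun :
    Continuous fun q : ℝ × UnitSphere ↦ rotateFun q.1 q.2 := by
  refine Continuous.subtype_mk ?_ _
  simp only [Complex.mk_eq_add_mul_I]
  fun_prop

theorem rotateFun_zero (p : UnitSphere) : rotateFun 0 p = p := by
  ext1; simp [rotateFun]

theorem rotateFun_neg (θ : ℝ) (p : UnitSphere) : rotateFun (-θ) (rotateFun θ p) = p := by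
  have h := Real.sin_sq_add_cos_sq θ
  ext1
  simp only [rotateFun, Real.cos_neg, Real.sin_neg]
  refine Prod.ext (Prod.ext (Complex.ext rfl ?_) rfl) ?_
  · linear_combination p.1.1.1.im * h
  · linear_combination p.1.2 * h

/-- The rotation of the sphere by a half turn, as a homeomorphism. -/
def halfTurn : UnitSphere ≃ₜ UnitSphere where
  toFun := rotateFun Real.pi
  invFun := rotateFun (-Real.pi)
  left_inv := rotateFun_neg _
  right_inv p := by simpa using rotateFun_neg (-Real.pi) p
  continuous_toFun := continuous_rotateFun.comp (by fun_prop : Continuous fun p ↦ (Real.pi, p))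
  continuous_invFun := continuous_rotateFun.comp (by fun_prop : Continuous fun p ↦ (-Real.pi, p))

theorem orientationPreserving_halfTurn (n : ℕ) : OrientationPreserving n halfTurn := by
  refine OrientationPreserving.refl.of_homotopy (fun q ↦ rotateFun (q.1 * Real.pi) q.2) ?_
    (fun p ↦ ?_) (fun p ↦ ?_)
  · exact continuous_rotateFun.comp
      (by fun_prop : Continuous fun q : unitInterval × UnitSphere ↦ ((q.1 : ℝ) * Real.pi, q.2))
  · simpa using rotateFun_zero p
  · simp
    rfl

/-- The factor by which `coneDilation` multiplies a vector. -/
def coneFactor (v : V) : ℝ := max (Complex.normSq v.1) (sqNorm v / 2) / sqNorm v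

theorem coneFactor_le_one (v : V) : coneFactor v ≤ 1 := by
  refine div_le_one_of_le₀ (max_le ?_ ?_) (sqNorm_nonneg v)
  · exact le_add_of_nonneg_right (sq_nonneg _)
  · linarith [sqNorm_nonneg v]

theorem half_le_coneFactor {v : V} (hv : v ≠ 0) : 1 / 2 ≤ coneFactor v := by
  have := sqNorm_pos hv
  rw [coneFactor, le_div_iff₀ this]
  exact le_trans (by linarith) (le_max_right _ _)

theorem coneFactor_pos {v : V} (hv : v ≠ 0) : 0 < coneFactor v :=
  lt_of_lt_of_le one_half_pos (half_le_coneFactor hv)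

/-- Homogeneity of degree zero makes the factor constant on each ray, so dividing by it inverts
`coneDilation`. -/
theorem coneFactor_smul {c : ℝ} (hc : c ≠ 0) (v : V) : coneFactor (c • v) = coneFactor v := by
  have hc2 : 0 < c ^ 2 := by positivity
  have : Complex.normSq (c • v).1 = c ^ 2 * Complex.normSq v.1 := by
    simp [Complex.normSq_apply]
    ring
  rw [coneFactor, coneFactor, sqNorm_smul, this, mul_div_assoc,
    ← mul_max_of_nonneg _ _ hc2.le, mul_div_mul_left _ _ hc2.ne']

theorem continuousAt_coneFactor {v : V} (hv : v ≠ 0) : ContinuousAt coneFactor v := by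
  have h := (sqNorm_pos hv).ne'
  have := Complex.continuous_normSq
  unfold coneFactor
  exact ContinuousAt.div (by fun_prop) (by fun_prop) h

theorem continuous_smul_of_bounded {f : V → ℝ} (hf : ∀ v, v ≠ 0 → ContinuousAt f v) {C : ℝ}
    (hC : ∀ v, ‖f v‖ ≤ C) : Continuous fun v ↦ f v • v := by
  rw [continuous_iff_continuousAt]
  intro v
  rcases eq_or_ne v 0 with rfl | hv
  · rw [ContinuousAt, smul_zero]
    refine squeeze_zero_norm (a := fun v ↦ C * ‖v‖) (fun v ↦ ?_) ?_
    · rw [norm_smul]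
      exact mul_le_mul_of_nonneg_right (hC v) (norm_nonneg v)
    · have : Continuous fun v : V ↦ C * ‖v‖ := by fun_prop
      simpa using this.tendsto 0
  · exact (hf v hv).smul continuousAt_id

/-- A homeomorphism moving each point along its ray, so that conjugate inversion after it is,
in a cone around the plane, conjugate inversion in the plane. -/
def coneDilation : V ≃ₜ V where
  toFun v := coneFactor v • v
  invFun v := (coneFactor v)⁻¹ • v
  left_inv v := by
    rcases eq_or_ne v 0 with rfl | hv
    · simp
    have := (coneFactor_pos hv).ne'
    beta_reduce
    rw [coneFactor_smul this, smul_smul, inv_mul_cancel₀ this, one_smul]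
  right_inv v := by
    rcases eq_or_ne v 0 with rfl | hv
    · simp
    have := (coneFactor_pos hv).ne'
    beta_reduce
    rw [coneFactor_smul (inv_ne_zero this), smul_smul, mul_inv_cancel₀ this, one_smul]
  continuous_toFun := continuous_smul_of_bounded (fun _ ↦ continuousAt_coneFactor) (C := 1)
    fun v ↦ by
      rcases eq_or_ne v 0 with rfl | hv
      · simp [coneFactor, sqNorm]
      rw [Real.norm_of_nonneg (coneFactor_pos hv).le]
      exact coneFactor_le_one v
  continuous_invFun := continuous_smul_of_bounded (fun v hv ↦ (continuousAt_coneFactor hv).inv₀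
      (coneFactor_pos hv).ne') (C := 2)
    fun v ↦ by
      rcases eq_or_ne v 0 with rfl | hv
      · simp [coneFactor, sqNorm]
      have h := half_le_coneFactor hv
      rw [norm_inv, Real.norm_of_nonneg (coneFactor_pos hv).le]
      exact inv_le_of_inv_le₀ (by norm_num) (by linarith)

theorem properlyHomotopic_coneDilation :
    ProperlyHomotopic (Homeomorph.refl V) coneDilation := by
  have := coneDilation.continuous
  refine ⟨fun p ↦ (1 - p.1) • p.2 + p.1 • coneDilation p.2,
    Continuous.continuousOn (by fun_prop), by simp, by simp, fun r ↦ ⟨2 * r, fun s hs v h ↦ ?_⟩⟩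
  rcases eq_or_ne v 0 with rfl | hv
  · simp at h ⊢
    linarith [(norm_nonneg (coneDilation 0)), norm_nonneg (s • coneDilation 0)]
  have e : (1 - s) • v + s • coneDilation v = (1 - s + s * coneFactor v) • v := by
    change (1 - s) • v + s • coneFactor v • v = _
    rw [smul_smul, ← add_smul]
  have h1 : 1 / 2 ≤ 1 - s + s * coneFactor v := by
    nlinarith [hs.1, hs.2, half_le_coneFactor hv]
  have h : ‖(1 - s) • v + s • coneDilation v‖ ≤ r := h
  rw [e, norm_smul, Real.norm_of_nonneg (by linarith)] at h
  nlinarith [norm_nonneg v]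

/-- On the sphere the half turn negates the last coordinate, which is inversion in the unit sphere
of `V`, and the imaginary coordinate, which is conjugation. Each alone reverses orientation;
together they form a rotation. -/
theorem stereo_symm_halfTurn_coe {v : V} (hv : v ≠ 0) :
    stereo.symm (halfTurn (stereo (v : OnePoint V))) =
      (((sqNorm v)⁻¹ • (starRingEnd ℂ v.1, v.2) : V) : OnePoint V) := by
  rw [Homeomorph.symm_apply_eq]
  have h := sqNorm_pos hv
  have hc : sqNorm ((sqNorm v)⁻¹ • (starRingEnd ℂ v.1, v.2) : V) = (sqNorm v)⁻¹ := by
    rw [sqNorm_smul]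
    have : sqNorm (starRingEnd ℂ v.1, v.2) = sqNorm v := by simp [sqNorm]
    rw [this]
    field_simp
  rw [stereo_apply, stereo_apply]
  change rotateFun Real.pi _ = _
  ext1
  simp only [stereoFun, OnePoint.elim_some, rotateFun, hc, Real.cos_pi, Real.sin_pi]
  have h1 : 2 / ((sqNorm v)⁻¹ + 1) * (sqNorm v)⁻¹ = 2 / (sqNorm v + 1) := by field_simp; ring
  rw [smul_smul, h1]
  refine Prod.ext (Prod.ext (Complex.ext ?_ ?_) rfl) ?_
  · simp only [Prod.smul_fst, Complex.smul_re, Complex.conj_re]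
  · simp only [Prod.smul_fst, Complex.smul_im, Complex.conj_im, smul_eq_mul]
    ring
  · simp only
    field_simp
    ring

/-- There is an orientation preserving homeomorphism of the sphere taking infinity to the origin
which in a cone around the horizontal plane covers the inversion `x ↦ x⁻¹` of that plane. -/
theorem exists_inversion : ∃ G : S3 ≃ₜ S3, OrientationPreserving 3 G ∧
    G OnePoint.infty = ((coords.symm 0 : E 3) : S3) ∧
    ∀ v : V, v.1 ≠ 0 → |v.2| ≤ ‖v.1‖ → G ((coords.symm v : E 3) : S3) =
      ((coords.symm (v.1⁻¹, v.2 / Complex.normSq v.1) : E 3) : S3) := by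
  let M : OnePoint V ≃ₜ OnePoint V := (stereo.trans halfTurn).trans stereo.symm
  have hM : OrientationPreserving 3 M := (orientationPreserving_halfTurn 3).conj stereo
  let M' : S3 ≃ₜ S3 := (coords.onePointCongr.trans M).trans coords.onePointCongr.symm
  have hM' : OrientationPreserving 3 M' := hM.conj coords.onePointCongr
  refine ⟨(extend coneDilation).trans M',
    (orientationPreserving_extend properlyHomotopic_coneDilation).trans hM', ?_, ?_⟩
  · have : M OnePoint.infty = ((0 : V) : OnePoint V) := by
      change stereo.symm _ = _
      rw [Homeomorph.symm_apply_eq]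
      rw [stereo_apply]
      change rotateFun Real.pi (stereo _) = _
      rw [stereo_apply]
      ext1
      simp only [rotateFun, stereoFun_infty, stereoFun_coe]
      refine Prod.ext (Prod.ext (Complex.ext ?_ ?_) ?_) ?_ <;> simp [sqNorm]
    rw [Homeomorph.trans_apply, extend_infty]
    change coords.onePointCongr.symm (M OnePoint.infty) = _
    rw [this]
    rfl
  · intro v hv hle
    rw [Homeomorph.trans_apply, extend_coe]
    have h1 : 0 < Complex.normSq v.1 := Complex.normSq_pos.2 hv
    have hv0 : v ≠ 0 := fun h ↦ hv (by simp [h])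
    have h2 := sqNorm_pos hv0
    have hle' : v.2 ^ 2 ≤ Complex.normSq v.1 := by
      rw [← Complex.sq_norm, ← sq_abs]
      exact pow_le_pow_left₀ (abs_nonneg _) hle 2
    -- In the cone the horizontal part is at least half of `sqNorm v`, so the maximum selects it.
    -- The dilated point then has `sqNorm` equal to `normSq v.1 ^ 2 / sqNorm v`, and conjugate
    -- inversion divides the conjugate of `v` by `normSq v.1`.
    have hf : coneFactor v = Complex.normSq v.1 / sqNorm v := by
      rw [coneFactor, max_eq_left]
      unfold sqNorm
      linarith
    have hf0 : coneFactor v ≠ 0 := by rw [hf]; positivity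
    have hJ : coneDilation v = coneFactor v • v := rfl
    change coords.onePointCongr.symm (M (coords.onePointCongr _)) = _
    have : M ((coneDilation v : V) : OnePoint V) =
        ((v.1⁻¹, v.2 / Complex.normSq v.1) : V) := by
      change stereo.symm (halfTurn (stereo _)) = _
      rw [hJ, stereo_symm_halfTurn_coe (smul_ne_zero hf0 hv0), sqNorm_smul, hf]
      congr 1
      have hs : ((Complex.normSq v.1 / sqNorm v) ^ 2 * sqNorm v)⁻¹ *
          (Complex.normSq v.1 / sqNorm v) = (Complex.normSq v.1)⁻¹ := by field_simp
      ext1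
      · simp only [Prod.smul_fst, Complex.real_smul, map_mul, Complex.conj_ofReal]
        rw [← mul_assoc, ← Complex.ofReal_mul, hs, Complex.inv_def, mul_comm]
      · simp only [Prod.smul_snd, smul_eq_mul]
        rw [← mul_assoc, hs]
        field_simp
    have e : coords.onePointCongr ((coords.symm (coneDilation v) : E 3) : S3) =
        ((coneDilation v : V) : OnePoint V) := by simp
    rw [e, this]
    rfl

end PolynomialKnots

end

noncomputable section

namespace PolynomialKnots

open Filter Topology

/-! ### Closing up a long knot -/

/-- The polynomial curve in `ℂ × ℝ` with components `x`, `y`, `z`. -/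
def polyCurve (x y z : ℝ[X]) (t : ℝ) : V := (⟨x.eval t, y.eval t⟩, z.eval t)

/-- The identification of the complex plane with the Euclidean plane. -/
def planeCoords : ℂ →L[ℝ] E 2 :=
  LinearMap.toContinuousLinearMap
    { toFun := fun w ↦ WithLp.toLp 2 ![w.re, w.im]
      map_add' := fun v w ↦ by ext i; fin_cases i <;> simp
      map_smul' := fun c w ↦ by ext i; fin_cases i <;> simp }

theorem planeCoords_injective : Function.Injective planeCoords := by
  intro v w h
  have h0 := congrArg (fun u : E 2 ↦ u 0) h
  have h1 := congrArg (fun u : E 2 ↦ u 1) h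
  exact Complex.ext h0 h1

/-- The vertical projection of three-space. -/
def verticalProjection : E 3 →ₗ[ℝ] E 2 where
  toFun v := WithLp.toLp 2 ![v 0, v 1]
  map_add' v w := by ext i; fin_cases i <;> simp
  map_smul' c w := by ext i; fin_cases i <;> simp

theorem verticalProjection_surjective : Function.Surjective verticalProjection := by
  intro w
  refine ⟨WithLp.toLp 2 ![w 0, w 1, 0], ?_⟩
  ext i
  fin_cases i <;> rfl

theorem linearIndependent_planeCoords {v w : ℂ} (h : v.re * w.im - w.re * v.im ≠ 0) :
    LinearIndependent ℝ ![planeCoords v, planeCoords w] := by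
  rw [LinearIndependent.pair_iff]
  intro a b hab
  rw [← map_smul, ← map_smul, ← map_add, ← map_zero planeCoords] at hab
  have := planeCoords_injective hab
  have hre : a * v.re + b * w.re = 0 := by simpa using congrArg Complex.re this
  have him : a * v.im + b * w.im = 0 := by simpa using congrArg Complex.im this
  constructor
  · exact (mul_eq_zero.1 (show a * (v.re * w.im - w.re * v.im) = 0 by
      linear_combination w.im * hre - w.re * him)).resolve_right h
  · exact (mul_eq_zero.1 (show b * (v.re * w.im - w.re * v.im) = 0 by
      linear_combination v.re * him - v.im * hre)).resolve_right h

theorem isOpenEmbedding_shift (s : ℝ) :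
    IsOpenEmbedding fun r : ℝ ↦ ((s + r : ℝ) : S1) :=
  OnePoint.isOpenEmbedding_coe.comp (Homeomorph.addLeft s).isOpenEmbedding

/-- A partition of unity argument. The admissible values at each `w` form a convex set, and near `w`
one constant is admissible because, by properness, only a compact set of parameters is mapped there.
The bound is arranged with the minimum `ρ` of `‖X‖`. -/
theorem exists_continuous_small {X : ℝ → ℂ} {z : ℝ → ℝ} (hX : Continuous X) (hz : Continuous z)
    (hX0 : ∀ t, X t ≠ 0) (hXp : Tendsto (fun t ↦ ‖X t‖) (cocompact ℝ) atTop) :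
    ∃ μ : ℂ → ℝ, Continuous μ ∧ (∀ w, 0 < μ w) ∧ ∀ t, |z t * μ (X t)| ≤ ‖X t‖ := by
  obtain ⟨t₀, ht₀⟩ := hX.norm.exists_forall_le hXp
  set ρ := ‖X t₀‖
  have hρ : 0 < ρ := norm_pos_iff.2 (hX0 t₀)
  have hconv : ∀ w : ℂ, Convex ℝ {c : ℝ | 0 < c ∧ ∀ t, X t = w → |z t| * c ≤ ρ} := by
    intro w a ha b hb α β hα hβ hαβ
    refine ⟨(convex_Ioi (0 : ℝ)) ha.1 hb.1 hα hβ hαβ, fun t ht ↦ ?_⟩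
    have h1 := ha.2 t ht
    have h2 := hb.2 t ht
    calc |z t| * (α • a + β • b) = α * (|z t| * a) + β * (|z t| * b) := by
          simp only [smul_eq_mul]; ring
      _ ≤ α * ρ + β * ρ := by gcongr
      _ = ρ := by rw [← add_mul, hαβ, one_mul]
  have hloc : ∀ w : ℂ, ∃ c : ℝ, ∀ᶠ w' in 𝓝 w,
      c ∈ {c : ℝ | 0 < c ∧ ∀ t, X t = w' → |z t| * c ≤ ρ} := by
    intro w
    have hev := hXp.eventually_gt_atTop (‖w‖ + 1)
    obtain ⟨C, hC, hCs⟩ := mem_cocompact.1 hev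
    obtain ⟨B, hB⟩ := (hC.image hz.abs).bddAbove
    refine ⟨ρ / (|B| + 1), ?_⟩
    filter_upwards [Metric.ball_mem_nhds w one_pos] with w' hw'
    refine ⟨by positivity, fun t ht ↦ ?_⟩
    have htC : t ∈ C := by
      by_contra hn
      have h1 : ‖w‖ + 1 < ‖X t‖ := hCs hn
      rw [ht] at h1
      have h2 := norm_sub_norm_le w' w
      rw [mem_ball_iff_norm] at hw'
      linarith
    have hB' : |z t| ≤ |B| + 1 := by
      linarith [hB ⟨t, htC, rfl⟩, le_abs_self B]
    calc |z t| * (ρ / (|B| + 1)) ≤ (|B| + 1) * (ρ / (|B| + 1)) := by gcongr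
      _ = ρ := by field_simp
  obtain ⟨g, hg⟩ := exists_continuous_forall_mem_convex_of_local_const hconv hloc
  refine ⟨g, g.continuous, fun w ↦ (hg w).1, fun t ↦ ?_⟩
  rw [abs_mul, abs_of_pos (hg _).1]
  exact ((hg (X t)).2 t rfl).trans (ht₀ t)

theorem tendsto_norm_eval_cocompact {p : ℝ[X]} (hp : 0 < p.natDegree) :
    Tendsto (fun t ↦ ‖p.eval t‖) (cocompact ℝ) atTop :=
  p.tendsto_norm_atTop (natDegree_pos_iff_degree_pos.1 hp) tendsto_norm_cocompact_atTop

theorem continuous_planeCurve (x y : ℝ[X]) :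
    Continuous fun t ↦ (⟨x.eval t, y.eval t⟩ : ℂ) := by
  simp only [Complex.mk_eq_add_mul_I]
  fun_prop

theorem hasDerivAt_planeCurve (x y : ℝ[X]) (t : ℝ) :
    HasDerivAt (fun t ↦ (⟨x.eval t, y.eval t⟩ : ℂ))
      ⟨x.derivative.eval t, y.derivative.eval t⟩ t := by
  simp only [Complex.mk_eq_add_mul_I]
  exact (x.hasDerivAt t).ofReal_comp.add ((y.hasDerivAt t).ofReal_comp.mul_const _)

/-- The singularities of the plane curve `(x, y)` are transverse double points, with parameter
values in `S`. -/
structure IsRegularPlaneCurve (x y : ℝ[X]) (S : Finset ℝ) : Prop where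
  transverse : ∀ s t, s ≠ t → x.eval s = x.eval t → y.eval s = y.eval t →
    x.derivative.eval s * y.derivative.eval t - x.derivative.eval t * y.derivative.eval s ≠ 0
  double : ∀ s t u, x.eval s = x.eval t → y.eval s = y.eval t → x.eval s = x.eval u →
    y.eval s = y.eval u → s = t ∨ s = u ∨ t = u
  mem : ∀ s t, s ≠ t → x.eval s = x.eval t → y.eval s = y.eval t → s ∈ S

/-- The curve meets the imaginary axis only at the finitely many roots of `x`. -/
theorem exists_notMem_planeCurve {x : ℝ[X]} (y : ℝ[X]) (hx : 0 < x.natDegree) :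
    ∃ q : ℂ, ∀ t, (⟨x.eval t, y.eval t⟩ : ℂ) ≠ q := by
  have hfin : {t : ℝ | x.eval t = 0}.Finite := by
    have hx0 : x ≠ 0 := by rintro rfl; simp at hx
    refine x.roots.toFinset.finite_toSet.subset fun t ht ↦ ?_
    simpa [hx0] using ht
  obtain ⟨b, hb⟩ := (hfin.image fun t ↦ y.eval t).exists_notMem
  refine ⟨⟨0, b⟩, fun t ht ↦ hb ⟨t, ?_, ?_⟩⟩
  · exact congrArg Complex.re ht
  · exact congrArg Complex.im ht

section Closing

variable {X : ℝ → ℂ} {z : ℝ → ℝ}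

/-- The closed curve obtained from a curve `(X, z)` in `ℂ × ℝ` by inversion in the plane. -/
def closedCurve (X : ℝ → ℂ) (z : ℝ → ℝ) (p : S1) : E 3 :=
  p.elim (coords.symm 0) fun t ↦ coords.symm ((X t)⁻¹, z t / Complex.normSq (X t))

theorem isEmbedding_onePoint_map {k : ℝ → V} (hk : Continuous k) (hinj : Function.Injective k)
    (hp : Tendsto (fun t ↦ ‖k t‖) (cocompact ℝ) atTop) :
    IsEmbedding (OnePoint.map (coords.symm ∘ k) : S1 → S3) := by
  have hp' : Tendsto k (cocompact ℝ) (cocompact V) := tendsto_cocompact_of_tendsto_dist_comp_atTop 0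
    (by simpa [dist_zero_right] using hp)
  have hc : Continuous (OnePoint.map (coords.symm ∘ k) : S1 → S3) := by
    refine OnePoint.continuous_map (coords.symm.continuous.comp hk) ?_
    rw [coclosedCompact_eq_cocompact, coclosedCompact_eq_cocompact]
    exact coords.symm.isClosedEmbedding.tendsto_cocompact.comp hp'
  refine (hc.isClosedEmbedding ?_).isEmbedding
  exact Option.map_injective (coords.symm.injective.comp hinj)

theorem exists_closedCurve_eq (hX0 : ∀ t, X t ≠ 0) (hzX : ∀ t, |z t| ≤ ‖X t‖) :
    ∃ G : S3 ≃ₜ S3, OrientationPreserving 3 G ∧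
      (fun p ↦ ((closedCurve X z p : E 3) : S3)) =
        G ∘ OnePoint.map (coords.symm ∘ fun t ↦ ((X t, z t) : V)) := by
  obtain ⟨G, hG, h0, h1⟩ := exists_inversion
  refine ⟨G, hG, ?_⟩
  ext1 p
  induction p using OnePoint.rec with
  | infty => exact h0.symm
  | coe t => exact (h1 (X t, z t) (hX0 t) (hzX t)).symm

/-- Inversion is injective and never takes the value `0`, the image of infinity, so closing up the
curve creates no new multiple points. -/
theorem eq_or_exists_of_projection_eq (hX0 : ∀ t, X t ≠ 0) {p q : S1}
    (h : (verticalProjection ∘ closedCurve X z) p = (verticalProjection ∘ closedCurve X z) q) :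
    p = q ∨ ∃ s t : ℝ, p = s ∧ q = t ∧ X s = X t := by
  induction p using OnePoint.rec with
  | infty =>
    induction q using OnePoint.rec with
    | infty => exact Or.inl rfl
    | coe t => exact absurd (planeCoords_injective h).symm (inv_ne_zero (hX0 t))
  | coe s =>
    induction q using OnePoint.rec with
    | infty => exact absurd (planeCoords_injective h) (inv_ne_zero (hX0 s))
    | coe t => exact Or.inr ⟨s, t, rfl, rfl, inv_injective (planeCoords_injective h)⟩

end Closing

/-- Inversion in the plane is holomorphic with nonzero derivative, so it preserves transversality.
Each multiple point has two preimages in `S`, which gives `2 * m ≤ S.card`. -/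
theorem regularProjection_closedCurve {x y : ℝ[X]} {S : Finset ℝ}
    (h : IsRegularPlaneCurve x y S) {q : ℂ} (hq : ∀ t, (⟨x.eval t, y.eval t⟩ : ℂ) ≠ q)
    (z : ℝ → ℝ) :
    RegularProjection (closedCurve (fun t ↦ ⟨x.eval t, y.eval t⟩ - q) z) verticalProjection ∧
      ∃ m : ℕ, (multiplePoints (verticalProjection ∘
        closedCurve (fun t ↦ ⟨x.eval t, y.eval t⟩ - q) z)).encard = m ∧ 2 * m ≤ S.card := by
  classical
  set X : ℝ → ℂ := fun t ↦ ⟨x.eval t, y.eval t⟩ - q with hX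
  have hX0 : ∀ t, X t ≠ 0 := fun t ↦ sub_ne_zero.2 (hq t)
  have hXeq : ∀ {s t}, X s = X t → x.eval s = x.eval t ∧ y.eval s = y.eval t := by
    intro s t hst
    have := sub_left_injective hst
    exact ⟨congrArg Complex.re this, congrArg Complex.im this⟩
  set γ := verticalProjection ∘ closedCurve X z with hγ
  have hmem : ∀ w ∈ multiplePoints γ, ∃ s ∈ S, ∃ t ∈ S, s ≠ t ∧ γ s = w ∧ γ t = w := by
    rintro w ⟨p, p', hne, hp, hp'⟩
    obtain h1 | ⟨s, t, rfl, rfl, hst⟩ := eq_or_exists_of_projection_eq hX0 (hp.trans hp'.symm)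
    · exact absurd h1 hne
    have hne' : s ≠ t := fun h ↦ hne (by rw [h])
    obtain ⟨h1, h2⟩ := hXeq hst
    exact ⟨s, h.mem s t hne' h1 h2, t, h.mem t s hne'.symm h1.symm h2.symm, hne', hp, hp'⟩
  have hsub : multiplePoints γ ⊆ (S.image fun t : ℝ ↦ γ t : Finset (E 2)) := by
    intro w hw
    obtain ⟨s, hs, -, -, -, hsw, -⟩ := hmem w hw
    exact Finset.mem_coe.2 (Finset.mem_image.2 ⟨s, hs, hsw⟩)
  have hfin : (multiplePoints γ).Finite := (Finset.finite_toSet _).subset hsub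
  refine ⟨⟨verticalProjection_surjective, hfin, fun w ↦ ?_, ?_⟩, hfin.toFinset.card, ?_, ?_⟩
  · by_contra! hlt
    obtain ⟨T, hTsub, hT⟩ := Set.exists_subset_encard_eq (Order.add_one_le_of_lt hlt)
    have hT3 : T.encard = 3 := by rw [hT]; norm_num
    obtain ⟨a, b, c, hab, hac, hbc, rfl⟩ := Set.encard_eq_three.1 hT3
    have ha : γ a = w := hTsub (by simp)
    have hb : γ b = w := hTsub (by simp)
    have hc : γ c = w := hTsub (by simp)
    obtain h1 | ⟨s, t, rfl, rfl, hst⟩ := eq_or_exists_of_projection_eq hX0 (ha.trans hb.symm)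
    · exact hab h1
    obtain h1 | ⟨s', u, hs', rfl, hsu⟩ := eq_or_exists_of_projection_eq hX0 (ha.trans hc.symm)
    · exact hac h1
    obtain rfl : s = s' := OnePoint.coe_injective hs'
    obtain ⟨h1, h2⟩ := hXeq hst
    obtain ⟨h3, h4⟩ := hXeq hsu
    rcases h.double s t u h1 h2 h3 h4 with rfl | rfl | rfl
    · exact hab rfl
    · exact hac rfl
    · exact hbc rfl
  · intro p p' hne heq
    obtain h1 | ⟨s, t, rfl, rfl, hst⟩ := eq_or_exists_of_projection_eq hX0 heq
    · exact absurd h1 hne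
    have hne' : s ≠ t := fun h ↦ hne (by rw [h])
    obtain ⟨h1, h2⟩ := hXeq hst
    have hder : ∀ r, HasDerivAt (γ ∘ fun a : ℝ ↦ ((r + a : ℝ) : S1))
        (planeCoords (-(⟨x.derivative.eval r, y.derivative.eval r⟩ : ℂ) / X r ^ 2)) 0 := by
      intro r
      have h3 : HasDerivAt X ⟨x.derivative.eval r, y.derivative.eval r⟩ (r + 0) := by
        rw [add_zero]
        exact (hasDerivAt_planeCurve x y r).sub_const q
      have h4 := (h3.comp_const_add r 0).fun_inv (by simpa using hX0 r)
      simp only [add_zero] at h4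
      exact planeCoords.hasFDerivAt.comp_hasDerivAt 0 h4
    refine ⟨_, _, isOpenEmbedding_shift s, isOpenEmbedding_shift t, by simp, by simp, _, _,
      hder s, hder t, ?_⟩
    have htr := h.transverse s t hne' h1 h2
    -- Since `X s = X t`, both tangent vectors are multiplied by the same complex number `c`, which
    -- scales their determinant by `normSq c`.
    rw [hst]
    set c : ℂ := -(X t ^ 2)⁻¹ with hc
    have hc0 : c ≠ 0 := neg_ne_zero.2 (inv_ne_zero (pow_ne_zero 2 (hX0 t)))
    have e : ∀ w : ℂ, -w / X t ^ 2 = c * w := fun w ↦ by rw [hc]; ring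
    rw [e, e]
    apply linearIndependent_planeCoords
    have hN : Complex.normSq c ≠ 0 := by simpa using hc0
    have : ∀ a b a' b' : ℝ, (c * ⟨a, b⟩).re * (c * ⟨a', b'⟩).im -
        (c * ⟨a', b'⟩).re * (c * ⟨a, b⟩).im = Complex.normSq c * (a * b' - a' * b) := by
      intro a b a' b'
      simp only [Complex.mul_re, Complex.mul_im, Complex.normSq_apply]
      ring
    rw [this]
    exact mul_ne_zero hN htr
  · exact hfin.encard_eq_coe_toFinset_card
  · have h1 : 2 * hfin.toFinset.card ≤ (S.filter fun t : ℝ ↦ γ t ∈ multiplePoints γ).card := by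
      refine Finset.mul_card_image_le_card_of_maps_to (f := fun t : ℝ ↦ γ t) ?_ 2 ?_
      · intro t ht
        simpa using (Finset.mem_filter.1 ht).2
      · intro w hw
        rw [Set.Finite.mem_toFinset] at hw
        obtain ⟨s, hs, t, ht, hne, hsw, htw⟩ := hmem w hw
        refine (Finset.card_pair hne).ge.trans (Finset.card_le_card ?_)
        intro a ha
        rcases Finset.mem_insert.1 ha with rfl | ha
        · simp [hs, hsw, hw]
        · rw [Finset.mem_singleton] at ha
          subst ha
          simp [ht, htw, hw]
    exact h1.trans (Finset.card_filter_le _ _)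

/-- A knot that is ambient isotopic to a polynomial curve with regular vertical projection has
crossing number at most the number of crossings of the projection. -/
theorem crossingNumber_le_of_isRegularPlaneCurve {k : ℝ → V} {x y z : ℝ[X]} {S : Finset ℝ}
    (hk : AmbientIsotopic k (polyCurve x y z)) (hkinj : Function.Injective k)
    (hx : 0 < x.natDegree) (h : IsRegularPlaneCurve x y S) :
    ∃ m : ℕ, crossingNumber (OnePoint.map (coords.symm ∘ k)) ≤ m ∧ 2 * m ≤ S.card := by
  obtain ⟨q, hq⟩ := exists_notMem_planeCurve y hx
  set X : ℝ → ℂ := fun t ↦ ⟨x.eval t, y.eval t⟩ - q with hX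
  have hXc : Continuous X := (continuous_planeCurve x y).sub continuous_const
  have hX0 : ∀ t, X t ≠ 0 := fun t ↦ sub_ne_zero.2 (hq t)
  have hXp : Tendsto (fun t ↦ ‖X t‖) (cocompact ℝ) atTop := by
    refine tendsto_atTop_mono (fun t ↦ ?_)
      (tendsto_atTop_add_const_right _ (-‖q‖) (tendsto_norm_eval_cocompact hx))
    have h1 := norm_sub_norm_le (⟨x.eval t, y.eval t⟩ : ℂ) q
    have h2 := Complex.abs_re_le_norm (⟨x.eval t, y.eval t⟩ : ℂ)
    simp only [Real.norm_eq_abs]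
    simp only at h2
    linarith
  obtain ⟨μ, hμc, hμpos, hμ⟩ := exists_continuous_small hXc z.continuous hX0 hXp
  -- Moving `q` to the origin and compressing vertically puts the whole curve in the cone where the
  -- inversion is explicit.
  have hiso : AmbientIsotopic k fun t ↦ (X t, z.eval t * μ (X t)) := by
    simpa [polyCurve, hX] using
      (hk.trans (AmbientIsotopic.translate _ (c := fun _ ↦ q) continuous_const)).trans
        (AmbientIsotopic.vertical _ hμc (ν := 0) continuous_zero hμpos)
  have hinj := hiso.injective hkinj
  obtain ⟨g, hg, hg0, hg1⟩ := hiso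
  obtain ⟨G, hG, hGe⟩ := exists_closedCurve_eq (z := fun t ↦ z.eval t * μ (X t)) hX0 hμ
  have hcomp : (OnePoint.map (coords.symm ∘ fun t ↦ ((X t, z.eval t * μ (X t)) : V)) : S1 → S3) =
      g ∘ OnePoint.map (coords.symm ∘ k) := by
    ext1 p
    induction p using OnePoint.rec with
    | infty => exact hg0.symm
    | coe t => exact (hg1 t).symm
  obtain ⟨hreg, m, hm, hmS⟩ := regularProjection_closedCurve h hq (fun t ↦ z.eval t * μ (X t))
  refine ⟨m, sInf_le ⟨_, _, ?_, ⟨Homeomorph.refl _, g.trans G, .refl, hg.trans hG, ?_⟩, hreg,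
    hm.symm⟩, hmS⟩
  · rw [← IsEmbedding.of_comp_iff (g := ((↑) : E 3 → S3)) OnePoint.isOpenEmbedding_coe.isEmbedding]
    change IsEmbedding fun p ↦ ((closedCurve X (fun t ↦ z.eval t * μ (X t)) p : E 3) : S3)
    rw [hGe]
    refine G.isEmbedding.comp (isEmbedding_onePoint_map (by fun_prop) hinj ?_)
    exact tendsto_atTop_mono (fun t ↦ le_max_left _ _) hXp
  · rw [hGe, hcomp]
    rfl

end PolynomialKnots

end

noncomputable section

namespace PolynomialKnots

open Filter Topology

/-! ### Divided differences -/

/-- The divided difference `(p s - p t) / (s - t)` of a polynomial of degree at most `n`. -/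
def divDiff (n : ℕ) (p : ℝ[X]) (s t : ℝ) : ℝ :=
  ∑ j ∈ Finset.range n, t ^ j * (divX^[j + 1] p).eval s

theorem divDiff_succ (n : ℕ) (p : ℝ[X]) (s t : ℝ) :
    divDiff (n + 1) p s t = p.divX.eval s + t * divDiff n p.divX s t := by
  simp only [divDiff, Finset.sum_range_succ', Finset.mul_sum]
  rw [add_comm]
  congr 1
  · simp
  · refine Finset.sum_congr rfl fun j _ ↦ ?_
    rw [Function.iterate_succ_apply]
    ring

theorem eval_eq_divX (p : ℝ[X]) (s : ℝ) : p.eval s = p.divX.eval s * s + p.coeff 0 := by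
  conv_lhs => rw [← divX_mul_X_add p]
  simp

theorem natDegree_divX_le {p : ℝ[X]} {n : ℕ} (hp : p.natDegree ≤ n + 1) :
    p.divX.natDegree ≤ n := by
  rw [natDegree_divX_eq_natDegree_tsub_one]
  omega

theorem eval_sub_eval_eq {n : ℕ} {p : ℝ[X]} (hp : p.natDegree ≤ n) (s t : ℝ) :
    p.eval s - p.eval t = (s - t) * divDiff n p s t := by
  induction n generalizing p with
  | zero =>
    rw [eq_C_of_natDegree_le_zero hp]
    simp [divDiff]
  | succ n ih =>
    rw [divDiff_succ, eval_eq_divX p s, eval_eq_divX p t]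
    linear_combination t * ih (natDegree_divX_le hp)

theorem divDiff_self {n : ℕ} {p : ℝ[X]} (hp : p.natDegree ≤ n) (t : ℝ) :
    divDiff n p t t = p.derivative.eval t := by
  induction n generalizing p with
  | zero =>
    rw [eq_C_of_natDegree_le_zero hp]
    simp [divDiff]
  | succ n ih =>
    rw [divDiff_succ, ih (natDegree_divX_le hp)]
    conv_rhs => rw [← divX_mul_X_add p]
    simp
    ring

theorem continuous_divDiff (n : ℕ) (p : ℝ[X]) :
    Continuous fun q : ℝ × ℝ ↦ divDiff n p q.1 q.2 := by
  unfold divDiff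
  fun_prop

/-- The polynomials `x`, `y`, `z` are the components of a polynomial knot. -/
structure IsKnotCurve (x y z : ℝ[X]) : Prop where
  injective : Function.Injective (polyCurve x y z)
  immersion : ∀ t, ¬ (x.derivative.eval t = 0 ∧ y.derivative.eval t = 0 ∧
    z.derivative.eval t = 0)

/-- The vector of divided differences is continuous up to the diagonal, where it is the derivative.
It vanishes nowhere, by injectivity off the diagonal and by immersion on it, so its norm has a
positive minimum on the compact square. -/
theorem IsKnotCurve.exists_le_norm {x y z : ℝ[X]} (h : IsKnotCurve x y z) {T₁ T₂ : ℝ}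
    (hT : T₁ ≤ T₂) : ∃ c : ℝ, 0 < c ∧ ∀ s ∈ Set.Icc T₁ T₂, ∀ t ∈ Set.Icc T₁ T₂,
      c * |s - t| ≤ ‖polyCurve x y z s - polyCurve x y z t‖ := by
  set D : ℝ × ℝ → V := fun q ↦ (⟨divDiff x.natDegree x q.1 q.2, divDiff y.natDegree y q.1 q.2⟩,
    divDiff z.natDegree z q.1 q.2) with hD
  have hDc : Continuous D := by
    have h1 := continuous_divDiff x.natDegree x
    have h2 := continuous_divDiff y.natDegree y
    have h3 := continuous_divDiff z.natDegree z
    simp only [hD, Complex.mk_eq_add_mul_I]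
    fun_prop
  have hsub : ∀ s t, polyCurve x y z s - polyCurve x y z t = (s - t) • D (s, t) := by
    intro s t
    have h1 := eval_sub_eval_eq (le_refl x.natDegree) s t
    have h2 := eval_sub_eval_eq (le_refl y.natDegree) s t
    have h3 := eval_sub_eval_eq (le_refl z.natDegree) s t
    refine Prod.ext (Complex.ext ?_ ?_) ?_ <;> simpa [polyCurve, hD]
  have hne : ∀ q, D q ≠ 0 := by
    rintro ⟨s, t⟩ h0
    rcases eq_or_ne s t with rfl | hst
    · apply h.immersion s
      rw [← divDiff_self (le_refl x.natDegree), ← divDiff_self (le_refl y.natDegree),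
        ← divDiff_self (le_refl z.natDegree)]
      exact ⟨congrArg (fun v : V ↦ v.1.re) h0, congrArg (fun v : V ↦ v.1.im) h0,
        congrArg (fun v : V ↦ v.2) h0⟩
    · apply hst
      apply h.injective
      rw [← sub_eq_zero, hsub, h0, smul_zero]
  obtain ⟨q, -, hq⟩ := (isCompact_Icc.prod isCompact_Icc).exists_isMinOn
    (s := Set.Icc T₁ T₂ ×ˢ Set.Icc T₁ T₂) ⟨(T₁, T₁), by simp [hT]⟩ hDc.norm.continuousOn
  refine ⟨‖D q‖, norm_pos_iff.2 (hne q), fun s hs t ht ↦ ?_⟩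
  rw [hsub, norm_smul, Real.norm_eq_abs, mul_comm]
  exact mul_le_mul_of_nonneg_left (hq (Set.mk_mem_prod hs ht)) (abs_nonneg _)

/-! ### Straightening the ends of a polynomial curve -/

theorem exists_ray_inverse {f : ℝ → ℝ} (hf : Continuous f) {T : ℝ}
    (hmono : StrictMonoOn f (Set.Ici T)) (htop : Tendsto f atTop atTop) :
    ∃ τ : ℝ → ℝ, Continuous τ ∧ (∀ ζ, T ≤ τ ζ) ∧ ∀ ζ, f (τ ζ) = max ζ (f T) := by
  -- Continuing `f` below `T` by a line of slope one gives an increasing homeomorphism of `ℝ`, whose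
  -- inverse is then truncated at `T`.
  set Z : ℝ → ℝ := fun t ↦ f (max t T) + min (t - T) 0 with hZ
  have hZm : StrictMono Z := by
    intro a b hab
    have h1 : f (max a T) ≤ f (max b T) :=
      hmono.monotoneOn (le_max_right a T) (le_max_right b T) (max_le_max_right T hab.le)
    rcases le_or_gt b T with hb | hb
    · have h2 : min (a - T) 0 < min (b - T) 0 := by
        rw [min_eq_left (by linarith), min_eq_left (by linarith)]
        linarith
      exact add_lt_add_of_le_of_lt h1 h2
    · have h2 : min (a - T) 0 ≤ min (b - T) 0 := min_le_min_right 0 (by linarith)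
      have h3 : f (max a T) < f (max b T) := by
        refine hmono (le_max_right a T) (le_max_right b T) ?_
        rw [max_eq_left hb.le]
        exact max_lt hab hb
      exact add_lt_add_of_lt_of_le h3 h2
  have hZs : Function.Surjective Z := by
    refine Continuous.surjective (by fun_prop) ?_ ?_
    · refine htop.congr' ?_
      filter_upwards [eventually_ge_atTop T] with t ht
      simp [hZ, ht]
    · have : Tendsto (fun t : ℝ ↦ t + (f T - T)) atBot atBot :=
        tendsto_atBot_add_const_right _ _ tendsto_id
      refine this.congr' ?_
      filter_upwards [eventually_le_atBot T] with t ht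
      simp [hZ, ht]
      ring
  set e := (hZm.orderIsoOfSurjective Z hZs).toHomeomorph with he
  have hZe : ∀ ζ, Z (e.symm ζ) = ζ := fun ζ ↦ e.apply_symm_apply ζ
  refine ⟨fun ζ ↦ max (e.symm ζ) T, by have := e.symm.continuous; fun_prop,
    fun ζ ↦ le_max_right _ _, fun ζ ↦ ?_⟩
  have h1 := hZe ζ
  simp only [hZ] at h1
  beta_reduce
  rcases le_total (e.symm ζ) T with h | h
  · rw [max_eq_right h] at h1 ⊢
    rw [min_eq_left (by linarith)] at h1
    rw [max_eq_right (by linarith)]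
  · rw [max_eq_left h] at h1 ⊢
    rw [min_eq_right (by linarith), add_zero] at h1
    have : f T ≤ f (e.symm ζ) := hmono.monotoneOn (Set.mem_Ici.2 le_rfl) h h
    rw [max_eq_left (by linarith), h1]

theorem exists_strictMonoOn_eval {z : ℝ[X]} (hd : 0 < z.natDegree) (hl : 0 < z.leadingCoeff) :
    ∃ T : ℝ, StrictMonoOn (fun t ↦ z.eval t) (Set.Ici T) := by
  have hev : ∀ᶠ t in atTop, 0 < z.derivative.eval t := by
    have hlead : 0 < z.derivative.leadingCoeff := by
      rw [leadingCoeff_derivative]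
      positivity
    rcases Nat.eq_zero_or_pos z.derivative.natDegree with h0 | h0
    · rw [eq_C_of_natDegree_eq_zero h0] at hlead ⊢
      exact Eventually.of_forall fun t ↦ by simpa using hlead
    · exact (tendsto_atTop_of_leadingCoeff_nonneg _ (natDegree_pos_iff_degree_pos.1 h0)
        hlead.le).eventually_gt_atTop 0
  obtain ⟨T, hT⟩ := eventually_atTop.1 hev
  refine ⟨T, strictMonoOn_of_deriv_pos (convex_Ici T) z.continuous.continuousOn fun t ht ↦ ?_⟩
  rw [interior_Ici] at ht
  rw [Polynomial.deriv]
  exact hT t ht.le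

/-- The branch `τ` parametrizes an end of the curve by its height and is frozen at `T` below height
`h`. Motions built from `τ` thus move the end but act in the same way at all heights below `h`. -/
theorem exists_ray {f : ℝ → ℝ} (hf : Continuous f) {T₀ : ℝ}
    (hmono : StrictMonoOn f (Set.Ici T₀)) (htop : Tendsto f atTop atTop) {h : ℝ}
    (hh : f T₀ ≤ h) : ∃ T : ℝ, T₀ ≤ T ∧ f T = h ∧ (∀ t ∈ Set.Icc T₀ T, f t ≤ h) ∧
      (∀ t, T ≤ t → h ≤ f t) ∧
      ∃ τ : ℝ → ℝ, Continuous τ ∧ (∀ ζ, ζ ≤ h → τ ζ = T) ∧ (∀ t, T ≤ t → τ (f t) = t) ∧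
        ∀ ζ, T ≤ τ ζ ∧ f (τ ζ) = max ζ h := by
  obtain ⟨τ₀, -, h1, h2⟩ := exists_ray_inverse hf hmono htop
  have hT₀ : T₀ ≤ τ₀ h := h1 h
  have hfT : f (τ₀ h) = h := by rw [h2, max_eq_left hh]
  have hmono' : StrictMonoOn f (Set.Ici (τ₀ h)) := hmono.mono (Set.Ici_subset_Ici.2 hT₀)
  obtain ⟨τ, hτc, hτ1, hτ2⟩ := exists_ray_inverse hf hmono' htop
  rw [hfT] at hτ2
  have hle : ∀ t, τ₀ h ≤ t → h ≤ f t := fun t ht ↦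
    hfT.ge.trans (hmono'.monotoneOn (Set.mem_Ici.2 le_rfl) ht ht)
  refine ⟨τ₀ h, hT₀, hfT, fun t ht ↦ ?_, hle, τ, hτc, fun ζ hζ ↦ ?_, fun t ht ↦ ?_,
    fun ζ ↦ ⟨hτ1 ζ, hτ2 ζ⟩⟩
  · exact (hmono.monotoneOn ht.1 hT₀ ht.2).trans hfT.le
  · apply hmono'.injOn (hτ1 ζ) (Set.mem_Ici.2 le_rfl)
    rw [hτ2, hfT, max_eq_right hζ]
  · apply hmono'.injOn (hτ1 _) ht
    rw [hτ2, max_eq_left (hle t ht)]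

/-- The plane curve with components `x` and `y`. -/
def planeCurve (x y : ℝ[X]) (t : ℝ) : ℂ := ⟨x.eval t, y.eval t⟩

@[fun_prop]
theorem continuous_planeCurve_apply (x y : ℝ[X]) : Continuous (planeCurve x y) :=
  continuous_planeCurve x y

/-- The ends of a polynomial curve can be straightened: they become vertical lines, while
between them the curve is only rotated and stretched horizontally. -/
def HasStraightening (z : ℝ[X]) (T₁ T₂ : ℝ) (u : ℂ → ℂ) : Prop :=
  ∀ x y : ℝ[X], Function.Injective (polyCurve x y z) →
    ContinuousAt u (planeCurve x y T₂ - planeCurve x y T₁) ∧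
    u (planeCurve x y T₂ - planeCurve x y T₁) ≠ 0 ∧
    AmbientIsotopic (polyCurve x y z) fun t ↦
      (planeCurve x y (max T₁ (min t T₂)) * u (planeCurve x y T₂ - planeCurve x y T₁), z.eval t)

theorem clamp_of_le {T₁ T₂ t : ℝ} (hT : T₁ ≤ T₂) (ht : t ≤ T₁) : max T₁ (min t T₂) = T₁ := by
  rw [min_eq_left (ht.trans hT), max_eq_left ht]

theorem clamp_of_ge {T₁ T₂ t : ℝ} (hT : T₁ ≤ T₂) (ht : T₂ ≤ t) : max T₁ (min t T₂) = T₂ := by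
  rw [min_eq_right ht, max_eq_right hT]

theorem clamp_of_mem {T₁ T₂ t : ℝ} (h₁ : T₁ ≤ t) (h₂ : t ≤ T₂) : max T₁ (min t T₂) = t := by
  rw [min_eq_left h₂, max_eq_right h₁]

theorem abs_min_sub_min_le (a b h : ℝ) : |min a h - min b h| ≤ |a - b| := by
  rcases le_total a h with h1 | h1 <;> rcases le_total b h with h2 | h2 <;>
    simp only [h1, h2, min_eq_left, min_eq_right] <;>
    rw [abs_le] <;> constructor <;> rcases abs_cases (a - b) with h3 | h3 <;> linarith

theorem abs_max_sub_max_le (a b h : ℝ) : |max h a - max h b| ≤ |a - b| := by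
  rcases le_total a h with h1 | h1 <;> rcases le_total b h with h2 | h2 <;>
    simp only [h1, h2, max_eq_left, max_eq_right] <;>
    rw [abs_le] <;> constructor <;> rcases abs_cases (a - b) with h3 | h3 <;> linarith

/-- Both ends go upwards. At each height `ζ ≥ h` they pass through two distinct points of the plane,
and a unique complex affine map sends these to `0` and `1`. This map is constant for `ζ ≤ h`, so the
middle part is only multiplied by `W⁻¹` and translated. -/
theorem exists_straightening_even {z : ℝ[X]} (hd : 0 < z.natDegree) (hl : 0 < z.leadingCoeff)
    (heven : Even z.natDegree) : ∃ (T₁ T₂ : ℝ) (u : ℂ → ℂ), T₁ ≤ T₂ ∧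
      (∀ s t, |z.eval (max T₁ (min s T₂)) - z.eval (max T₁ (min t T₂))| ≤
        |z.eval s - z.eval t|) ∧ HasStraightening z T₁ T₂ u := by
  set w : ℝ[X] := z.comp (-X) with hw
  have hwe : ∀ t, w.eval t = z.eval (-t) := fun t ↦ by simp [hw]
  have hwd : w.natDegree = z.natDegree := by simp [hw, natDegree_comp]
  have hwl : w.leadingCoeff = z.leadingCoeff := by
    rw [hw, leadingCoeff_comp (by simp)]
    simp [heven.neg_one_pow]
  obtain ⟨A, hA⟩ := exists_strictMonoOn_eval hd hl
  obtain ⟨B, hB⟩ := exists_strictMonoOn_eval (hwd ▸ hd) (hwl ▸ hl)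
  -- The bound `1` separates the two ends: `-σ ζ ≤ -1 < 1 ≤ τ ζ`, so injectivity of the curve
  -- applies to these parameters.
  set T₀ : ℝ := max (max A B) 1 with hT₀
  have hT₀1 : 1 ≤ T₀ := le_max_right _ _
  have hA' := hA.mono (Set.Ici_subset_Ici.2 ((le_max_left A B).trans (le_max_left _ 1)))
  have hB' := hB.mono (Set.Ici_subset_Ici.2 ((le_max_right A B).trans (le_max_left _ 1)))
  obtain ⟨h, hh⟩ := (isCompact_Icc (a := -T₀) (b := T₀)).bddAbove_image z.continuous.continuousOn
  have hh : ∀ t ∈ Set.Icc (-T₀) T₀, z.eval t ≤ h := fun t ht ↦ hh ⟨t, ht, rfl⟩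
  obtain ⟨T₂, hT₂, hzT₂, hle₂, hge₂, τ, hτc, hτ1, hτ2, hτ3⟩ := exists_ray z.continuous hA'
    (tendsto_atTop_of_leadingCoeff_nonneg z (natDegree_pos_iff_degree_pos.1 hd) hl.le)
    (hh T₀ ⟨by linarith, le_rfl⟩)
  obtain ⟨T', hT', hzT', hle', hge', σ, hσc, hσ1, hσ2, hσ3⟩ := exists_ray w.continuous hB'
    (tendsto_atTop_of_leadingCoeff_nonneg w (natDegree_pos_iff_degree_pos.1 (hwd ▸ hd))
      (hwl ▸ hl.le)) ((hwe T₀).trans_le (hh (-T₀) ⟨le_rfl, by linarith⟩))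
  simp only [hwe] at hzT' hle' hge' hσ2 hσ3
  have hT : -T' ≤ T₂ := by linarith
  have hmid : ∀ t, -T' ≤ t → t ≤ T₂ → z.eval t ≤ h := by
    intro t h1 h2
    rcases le_total t (-T₀) with h3 | h3
    · simpa using hle' (-t) ⟨by linarith, by linarith⟩
    · rcases le_total t T₀ with h4 | h4
      · exact hh t ⟨h3, h4⟩
      · exact hle₂ t ⟨h4, h2⟩
  have hclamp : ∀ t, z.eval (max (-T') (min t T₂)) = min (z.eval t) h := by
    intro t
    rcases le_total t (-T') with h1 | h1
    · rw [clamp_of_le hT h1, hzT', min_eq_right]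
      simpa using hge' (-t) (by linarith)
    · rcases le_total t T₂ with h2 | h2
      · rw [clamp_of_mem h1 h2, min_eq_left (hmid t h1 h2)]
      · rw [clamp_of_ge hT h2, hzT₂, min_eq_right (hge₂ t h2)]
  refine ⟨-T', T₂, fun W ↦ W⁻¹, hT, fun s t ↦ ?_, fun x y hinj ↦ ?_⟩
  · rw [hclamp, hclamp]
    exact abs_min_sub_min_le _ _ _
  have hne : ∀ ζ, planeCurve x y (τ ζ) - planeCurve x y (-σ ζ) ≠ 0 := by
    intro ζ h0
    have h1 : polyCurve x y z (τ ζ) = polyCurve x y z (-σ ζ) :=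
      Prod.ext (sub_eq_zero.1 h0) ((hτ3 ζ).2.trans (hσ3 ζ).2.symm)
    have h2 := hinj h1
    linarith [(hτ3 ζ).1, (hσ3 ζ).1]
  have hW : planeCurve x y T₂ - planeCurve x y (-T') ≠ 0 := by
    simpa [hτ1 h le_rfl, hσ1 h le_rfl] using hne h
  set W := planeCurve x y T₂ - planeCurve x y (-T') with hWdef
  refine ⟨continuousAt_inv₀ hW, inv_ne_zero hW, ?_⟩
  -- The last translation replaces `0` and `1` by the endpoints of the middle part multiplied by
  -- `W⁻¹`.
  have key := ((AmbientIsotopic.translate (polyCurve x y z)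
    (c := fun ζ ↦ planeCurve x y (-σ ζ)) (by fun_prop)).trans (AmbientIsotopic.mul _
      (u := fun ζ ↦ (planeCurve x y (τ ζ) - planeCurve x y (-σ ζ))⁻¹)
      (by fun_prop (disch := exact hne _)) fun ζ ↦ inv_ne_zero (hne ζ))).trans
    (AmbientIsotopic.translate _ (c := fun _ ↦ -(planeCurve x y (-T') * W⁻¹)) continuous_const)
  convert key using 3 with t
  swap
  · rfl
  change _ = (planeCurve x y t - planeCurve x y (-σ (z.eval t))) *
    (planeCurve x y (τ (z.eval t)) - planeCurve x y (-σ (z.eval t)))⁻¹ -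
      -(planeCurve x y (-T') * W⁻¹)
  rcases le_total t (-T') with h1 | h1
  · have := hσ2 (-t) (by linarith)
    rw [neg_neg] at this
    rw [clamp_of_le hT h1, this, neg_neg]
    ring
  · rcases le_total t T₂ with h2 | h2
    · rw [clamp_of_mem h1 h2, hτ1 _ (hmid t h1 h2), hσ1 _ (hmid t h1 h2)]
      ring
    · have h3 := hne (z.eval t)
      rw [hτ2 t h2] at h3 ⊢
      rw [clamp_of_ge hT h2, mul_inv_cancel₀ h3, ← mul_inv_cancel₀ hW, hWdef]
      ring

/-- The ends go in opposite directions: only the right one rises above `h` and only the left one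
falls below `-h`. A height-dependent translation therefore straightens both, with no rescaling. -/
theorem exists_straightening_odd {z : ℝ[X]} (hl : 0 < z.leadingCoeff)
    (hodd : Odd z.natDegree) : ∃ (T₁ T₂ : ℝ) (u : ℂ → ℂ), T₁ ≤ T₂ ∧
      (∀ s t, |z.eval (max T₁ (min s T₂)) - z.eval (max T₁ (min t T₂))| ≤
        |z.eval s - z.eval t|) ∧ HasStraightening z T₁ T₂ u := by
  have hd : 0 < z.natDegree := hodd.pos
  set w : ℝ[X] := -z.comp (-X) with hw
  have hwe : ∀ t, w.eval t = -z.eval (-t) := fun t ↦ by simp [hw]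
  have hwd : w.natDegree = z.natDegree := by simp [hw, natDegree_comp]
  have hwl : w.leadingCoeff = z.leadingCoeff := by
    rw [hw, leadingCoeff_neg, leadingCoeff_comp (by simp)]
    simp [hodd.neg_one_pow]
  obtain ⟨A, hA⟩ := exists_strictMonoOn_eval hd hl
  obtain ⟨B, hB⟩ := exists_strictMonoOn_eval (hwd ▸ hd) (hwl ▸ hl)
  set T₀ : ℝ := max (max A B) 1 with hT₀
  have hT₀1 : 1 ≤ T₀ := le_max_right _ _
  have hA' := hA.mono (Set.Ici_subset_Ici.2 ((le_max_left A B).trans (le_max_left _ 1)))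
  have hB' := hB.mono (Set.Ici_subset_Ici.2 ((le_max_right A B).trans (le_max_left _ 1)))
  obtain ⟨h, hh⟩ := (isCompact_Icc (a := -T₀) (b := T₀)).bddAbove_image
    z.continuous.abs.continuousOn
  have hh : ∀ t ∈ Set.Icc (-T₀) T₀, |z.eval t| ≤ h := fun t ht ↦ hh ⟨t, ht, rfl⟩
  have hT₀h := abs_le.1 (hh T₀ ⟨by linarith, le_rfl⟩)
  have hT₀h' := abs_le.1 (hh (-T₀) ⟨le_rfl, by linarith⟩)
  obtain ⟨T₂, hT₂, hzT₂, hle₂, hge₂, τ, hτc, hτ1, hτ2, hτ3⟩ := exists_ray z.continuous hA'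
    (tendsto_atTop_of_leadingCoeff_nonneg z (natDegree_pos_iff_degree_pos.1 hd) hl.le)
    hT₀h.2
  obtain ⟨T', hT', hzT', hle', hge', σ, hσc, hσ1, hσ2, hσ3⟩ := exists_ray w.continuous hB'
    (tendsto_atTop_of_leadingCoeff_nonneg w (natDegree_pos_iff_degree_pos.1 (hwd ▸ hd))
      (hwl ▸ hl.le)) (by rw [hwe]; linarith [hT₀h'.1] : w.eval T₀ ≤ h)
  simp only [hwe] at hzT' hle' hge' hσ2 hσ3
  have hT : -T' ≤ T₂ := by linarith
  have hh0 : 0 ≤ h := (abs_nonneg _).trans (hh T₀ ⟨by linarith, le_rfl⟩)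
  have hmono₂ : ∀ t, T₀ ≤ t → -h ≤ z.eval t := fun t ht ↦
    hT₀h.1.trans (hA'.monotoneOn (Set.mem_Ici.2 le_rfl) ht ht)
  have hmono' : ∀ t, T₀ ≤ t → z.eval (-t) ≤ h := fun t ht ↦ by
    have := hB'.monotoneOn (Set.mem_Ici.2 le_rfl) ht ht
    simp only [hwe] at this
    linarith [hT₀h'.2]
  have hmid : ∀ t, -T' ≤ t → t ≤ T₂ → -h ≤ z.eval t ∧ z.eval t ≤ h := by
    intro t h1 h2
    rcases le_total t (-T₀) with h3 | h3
    · have := hle' (-t) ⟨by linarith, by linarith⟩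
      have h5 := hmono' (-t) (by linarith)
      rw [neg_neg] at this h5
      exact ⟨by linarith, h5⟩
    · rcases le_total t T₀ with h4 | h4
      · exact abs_le.1 (hh t ⟨h3, h4⟩)
      · exact ⟨hmono₂ t h4, hle₂ t ⟨h4, h2⟩⟩
  have hleft : ∀ t, t ≤ -T' → z.eval t ≤ -h := by
    intro t ht
    have := hge' (-t) (by linarith)
    rw [neg_neg] at this
    linarith
  have hclamp : ∀ t, z.eval (max (-T') (min t T₂)) = max (-h) (min (z.eval t) h) := by
    intro t
    rcases le_total t (-T') with h1 | h1
    · have := hleft t h1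
      rw [clamp_of_le hT h1, min_eq_left (by linarith), max_eq_left this]
      linarith
    · rcases le_total t T₂ with h2 | h2
      · rw [clamp_of_mem h1 h2, min_eq_left (hmid t h1 h2).2, max_eq_right (hmid t h1 h2).1]
      · rw [clamp_of_ge hT h2, hzT₂, min_eq_right (hge₂ t h2), max_eq_right (by linarith)]
  refine ⟨-T', T₂, fun _ ↦ 1, hT, fun s t ↦ ?_, fun x y hinj ↦ ⟨continuousAt_const,
    one_ne_zero, ?_⟩⟩
  · rw [hclamp, hclamp]
    exact (abs_max_sub_max_le _ _ _).trans (abs_min_sub_min_le _ _ _)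
  convert AmbientIsotopic.translate (polyCurve x y z) (c := fun ζ ↦ planeCurve x y (τ ζ) -
    planeCurve x y T₂ + (planeCurve x y (-σ (-ζ)) - planeCurve x y (-T'))) (by fun_prop)
    using 3 with t
  swap
  · rfl
  change _ = planeCurve x y t - (planeCurve x y (τ (z.eval t)) - planeCurve x y T₂ +
    (planeCurve x y (-σ (-z.eval t)) - planeCurve x y (-T')))
  rcases le_total t (-T') with h1 | h1
  · have := hσ2 (-t) (by linarith)
    rw [neg_neg] at this
    rw [clamp_of_le hT h1, this, neg_neg, hτ1 _ (by linarith [hleft t h1])]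
    ring
  · rcases le_total t T₂ with h2 | h2
    · rw [clamp_of_mem h1 h2, hτ1 _ (hmid t h1 h2).2, hσ1 _ (by linarith [(hmid t h1 h2).1])]
      ring
    · rw [clamp_of_ge hT h2, hτ2 t h2, hσ1 _ (by linarith [hge₂ t h2])]
      ring

/-! ### Small perturbations of the horizontal components -/

/-- The space of parameters for perturbations of a plane curve. -/
abbrev Params : Type := (ℝ × ℝ) × (ℝ × ℝ)

/-- A perturbation of a polynomial by terms of degree one and two. -/
def perturb (p : ℝ[X]) (a b : ℝ) : ℝ[X] := p + C a * X + C b * X ^ 2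

@[simp]
theorem eval_perturb (p : ℝ[X]) (a b t : ℝ) :
    (perturb p a b).eval t = p.eval t + a * t + b * t ^ 2 := by simp [perturb]

theorem norm_le_abs_add_abs (a b : ℝ) : ‖(⟨a, b⟩ : ℂ)‖ ≤ |a| + |b| :=
  Complex.norm_le_abs_re_add_abs_im _

theorem norm_perturb_sub_le (x y : ℝ[X]) (p : Params) {s t R : ℝ} (hs : |s| ≤ R) (ht : |t| ≤ R) :
    ‖(planeCurve (perturb x p.1.1 p.2.1) (perturb y p.1.2 p.2.2) s - planeCurve x y s) -
      (planeCurve (perturb x p.1.1 p.2.1) (perturb y p.1.2 p.2.2) t - planeCurve x y t)‖ ≤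
      ‖p‖ * (2 + 4 * R) * |s - t| := by
  have e : (planeCurve (perturb x p.1.1 p.2.1) (perturb y p.1.2 p.2.2) s - planeCurve x y s) -
      (planeCurve (perturb x p.1.1 p.2.1) (perturb y p.1.2 p.2.2) t - planeCurve x y t) =
      ⟨(p.1.1 + p.2.1 * (s + t)) * (s - t), (p.1.2 + p.2.2 * (s + t)) * (s - t)⟩ := by
    refine Complex.ext ?_ ?_ <;> simp [planeCurve] <;> ring
  rw [e]
  refine (norm_le_abs_add_abs _ _).trans ?_
  rw [abs_mul, abs_mul, ← add_mul]
  refine mul_le_mul_of_nonneg_right ?_ (abs_nonneg _)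
  have h1 : |p.1.1| ≤ ‖p‖ := (norm_fst_le p.1).trans (norm_fst_le p)
  have h2 : |p.1.2| ≤ ‖p‖ := (norm_snd_le p.1).trans (norm_fst_le p)
  have h3 : |p.2.1| ≤ ‖p‖ := (norm_fst_le p.2).trans (norm_snd_le p)
  have h4 : |p.2.2| ≤ ‖p‖ := (norm_snd_le p.2).trans (norm_snd_le p)
  have h5 : |s + t| ≤ 2 * R := (abs_add_le s t).trans (by linarith)
  have h6 : ∀ a b : ℝ, |a| ≤ ‖p‖ → |b| ≤ ‖p‖ → |a + b * (s + t)| ≤ ‖p‖ + ‖p‖ * (2 * R) := by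
    intro a b ha hb
    refine (abs_add_le _ _).trans (add_le_add ha ?_)
    rw [abs_mul]
    gcongr
  linarith [h6 _ _ h1 h3, h6 _ _ h2 h4]

theorem perturb_zero (x : ℝ[X]) : perturb x 0 0 = x := by simp [perturb]

/-- The perturbation is unbounded at infinity, so the curves are compared after straightening. As
`T₁`, `T₂` and `u` depend only on `z`, which is unchanged, the straightened curves differ through
their values on `[T₁, T₂]` alone. There the displacement is small relative to chord lengths, and
`AmbientIsotopic.of_lipschitz` applies. -/
theorem eventually_ambientIsotopic_perturb {x y z : ℝ[X]} (h : IsKnotCurve x y z)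
    (hd : 0 < z.natDegree) (hl : 0 < z.leadingCoeff) :
    ∀ᶠ p : Params in 𝓝 0,
      Function.Injective (polyCurve (perturb x p.1.1 p.2.1) (perturb y p.1.2 p.2.2) z) →
      AmbientIsotopic (polyCurve x y z)
        (polyCurve (perturb x p.1.1 p.2.1) (perturb y p.1.2 p.2.2) z) := by
  obtain ⟨T₁, T₂, u, hT, hclamp, hstr⟩ : ∃ (T₁ T₂ : ℝ) (u : ℂ → ℂ), T₁ ≤ T₂ ∧
      (∀ s t, |z.eval (max T₁ (min s T₂)) - z.eval (max T₁ (min t T₂))| ≤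
        |z.eval s - z.eval t|) ∧ HasStraightening z T₁ T₂ u := by
    rcases Nat.even_or_odd z.natDegree with he | ho
    · exact exists_straightening_even hd hl he
    · exact exists_straightening_odd hl ho
  obtain ⟨c, hc, hlow⟩ := h.exists_le_norm hT
  obtain ⟨ε, hε, hlip⟩ := AmbientIsotopic.of_lipschitz
  set Γ : Params → ℝ → ℂ := fun p ↦
    planeCurve (perturb x p.1.1 p.2.1) (perturb y p.1.2 p.2.2) with hΓ
  have hΓ0 : Γ 0 = planeCurve x y := by simp [hΓ, perturb_zero]
  set W : Params → ℂ := fun p ↦ Γ p T₂ - Γ p T₁ with hW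
  obtain ⟨huc, hu0, hiso⟩ := hstr x y h.injective
  rw [← hΓ0] at huc hu0 hiso
  change ContinuousAt u (W 0) at huc
  change u (W 0) ≠ 0 at hu0
  have hWc : Continuous W := by
    simp only [hW, hΓ, planeCurve, eval_perturb, Complex.mk_eq_add_mul_I]
    fun_prop
  set R : ℝ := max |T₁| |T₂| with hR
  -- A lower bound for the stretching: straightening scales horizontal differences by `‖u (W 0)‖`,
  -- and vertical differences are at least those at the clamped parameters.
  set m : ℝ := min ‖u (W 0)‖ 1 with hm
  have hmpos : 0 < m := lt_min (norm_pos_iff.2 hu0) one_pos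
  have htend : Tendsto (fun p : Params ↦ ‖u (W p) - u (W 0)‖ +
      ‖u (W p)‖ * (‖p‖ * (2 + 4 * R) / c)) (𝓝 0) (𝓝 0) := by
    have h1 : ContinuousAt (fun p ↦ u (W p)) 0 := huc.comp hWc.continuousAt
    have h2 : ContinuousAt (fun p : Params ↦ ‖u (W p) - u (W 0)‖ +
      ‖u (W p)‖ * (‖p‖ * (2 + 4 * R) / c)) 0 := by fun_prop
    simpa [ContinuousAt] using h2
  filter_upwards [htend.eventually_le_const (show 0 < ε * m by positivity)] with p hp hinj
  obtain ⟨-, -, hiso'⟩ := hstr _ _ hinj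
  change AmbientIsotopic _ fun t ↦ (Γ p (max T₁ (min t T₂)) * u (W p), z.eval t) at hiso'
  change AmbientIsotopic _ fun t ↦ (Γ 0 (max T₁ (min t T₂)) * u (W 0), z.eval t) at hiso
  refine (hiso.trans (hlip _ _ fun s t ↦ ?_)).trans hiso'.symm
  have hmem : ∀ t, max T₁ (min t T₂) ∈ Set.Icc T₁ T₂ := fun t ↦
    ⟨le_max_left _ _, max_le hT (min_le_right _ _)⟩
  have habs : ∀ t, |max T₁ (min t T₂)| ≤ R := fun t ↦
    abs_le_max_abs_abs (hmem t).1 (hmem t).2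
  set s' := max T₁ (min s T₂) with hs'
  set t' := max T₁ (min t T₂) with ht'
  have hk := hlow s' (hmem s) t' (hmem t)
  have hnorm : m * ‖polyCurve x y z s' - polyCurve x y z t'‖ ≤
      ‖((Γ 0 s' * u (W 0), z.eval s) : V) - (Γ 0 t' * u (W 0), z.eval t)‖ := by
    rw [Prod.norm_def, mul_max_of_nonneg _ _ hmpos.le, Prod.norm_def]
    refine max_le_max ?_ ?_
    · change m * ‖planeCurve x y s' - planeCurve x y t'‖ ≤ ‖Γ 0 s' * u (W 0) - Γ 0 t' * u (W 0)‖
      rw [← sub_mul, norm_mul, hΓ0, mul_comm]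
      exact mul_le_mul_of_nonneg_left (min_le_left _ _) (norm_nonneg _)
    · change m * |z.eval s' - z.eval t'| ≤ |z.eval s - z.eval t|
      calc m * |z.eval s' - z.eval t'| ≤ 1 * |z.eval s' - z.eval t'| :=
            mul_le_mul_of_nonneg_right (min_le_right _ _) (abs_nonneg _)
        _ ≤ _ := by rw [one_mul]; exact hclamp s t
  have hdiff : ‖(((Γ p s' * u (W p), z.eval s) : V) - (Γ 0 s' * u (W 0), z.eval s)) -
      ((Γ p t' * u (W p), z.eval t) - (Γ 0 t' * u (W 0), z.eval t))‖ ≤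
      (‖u (W p) - u (W 0)‖ + ‖u (W p)‖ * (‖p‖ * (2 + 4 * R) / c)) *
        ‖polyCurve x y z s' - polyCurve x y z t'‖ := by
    have e : (((Γ p s' * u (W p), z.eval s) : V) - (Γ 0 s' * u (W 0), z.eval s)) -
      ((Γ p t' * u (W p), z.eval t) - (Γ 0 t' * u (W 0), z.eval t)) =
      ((u (W p) - u (W 0)) * (planeCurve x y s' - planeCurve x y t') +
        u (W p) * ((Γ p s' - planeCurve x y s') - (Γ p t' - planeCurve x y t')), 0) := by
      rw [hΓ0]
      refine Prod.ext ?_ ?_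
      · simp only [Prod.fst_sub]
        ring
      · simp
    rw [e, Prod.norm_mk, norm_zero, max_eq_left (norm_nonneg _), add_mul]
    refine (norm_add_le _ _).trans (add_le_add ?_ ?_)
    · rw [norm_mul]
      exact mul_le_mul_of_nonneg_left (le_max_left _ _) (norm_nonneg _)
    · rw [norm_mul, mul_assoc]
      refine mul_le_mul_of_nonneg_left ?_ (norm_nonneg _)
      refine (norm_perturb_sub_le x y p (habs s) (habs t)).trans ?_
      rw [div_mul_eq_mul_div, le_div_iff₀ hc, mul_assoc]
      refine mul_le_mul_of_nonneg_left (by linarith) ?_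
      have : 0 ≤ R := (abs_nonneg _).trans (le_max_left _ _)
      positivity
  calc _ ≤ _ := hdiff
    _ ≤ ε * m * ‖polyCurve x y z s' - polyCurve x y z t'‖ :=
        mul_le_mul_of_nonneg_right hp (norm_nonneg _)
    _ ≤ _ := by
        rw [mul_assoc]
        exact mul_le_mul_of_nonneg_left hnorm hε.le

end PolynomialKnots

end

noncomputable section

namespace PolynomialKnots

open Filter Topology

/-! ### The resultant of two divided differences -/

/-- The divided difference of a polynomial of degree at most `n`, as a polynomial in two
variables. -/
def divDiffPoly (n : ℕ) (p : ℝ[X]) : ℝ[X][X] :=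
  ∑ j ∈ Finset.range n, C (divX^[j + 1] p) * X ^ j

theorem coeff_divDiffPoly (n : ℕ) (p : ℝ[X]) (j : ℕ) :
    (divDiffPoly n p).coeff j = if j < n then divX^[j + 1] p else 0 := by
  simp [divDiffPoly, coeff_C_mul, coeff_X_pow, Finset.sum_ite_eq]

theorem eval_eval_divDiffPoly (n : ℕ) (p : ℝ[X]) (s t : ℝ) :
    ((divDiffPoly n p).eval (C t)).eval s = divDiff n p s t := by
  simp only [divDiffPoly, divDiff, eval_finsetSum, eval_mul, eval_C, eval_pow, eval_X]
  exact Finset.sum_congr rfl fun j _ ↦ mul_comm _ _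

theorem natDegree_iterate_divX (p : ℝ[X]) (j : ℕ) :
    (divX^[j] p).natDegree = p.natDegree - j := by
  induction j with
  | zero => simp
  | succ j ih =>
    rw [Function.iterate_succ_apply', natDegree_divX_eq_natDegree_tsub_one, ih]
    omega

theorem coeff_iterate_divX (p : ℝ[X]) (j i : ℕ) : (divX^[j] p).coeff i = p.coeff (i + j) := by
  induction j generalizing i with
  | zero => simp
  | succ j ih => rw [Function.iterate_succ_apply', coeff_divX, ih, add_right_comm, add_assoc]

theorem natDegree_divDiffPoly_le (m : ℕ) (p : ℝ[X]) :
    (divDiffPoly (m + 1) p).natDegree ≤ m := by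
  rw [natDegree_le_iff_coeff_eq_zero]
  intro j hj
  rw [coeff_divDiffPoly, if_neg (by omega)]

theorem map_divDiffPoly_zero {m : ℕ} {p : ℝ[X]} (hp : p.natDegree ≤ m + 1) :
    (divDiffPoly (m + 1) p).map (evalRingHom 0) = p.divX := by
  ext j
  rw [coeff_map, coeff_divDiffPoly, coeff_divX]
  split_ifs with h
  · rw [coe_evalRingHom, ← coeff_zero_eq_eval_zero, coeff_iterate_divX, zero_add]
  · rw [map_zero, coeff_eq_zero_of_natDegree_lt (by omega)]

/-- In each Leibniz term a permutation uses every row and column once, so the entrywise bounds add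
up to the same total. If the row weights exceed the column weights, every term vanishes. -/
theorem natDegree_det_le {ι : Type*} [Fintype ι] [DecidableEq ι] (M : Matrix ι ι ℝ[X])
    (c w : ι → ℕ) (h : ∀ i j, M i j ≠ 0 → (M i j).natDegree + w i ≤ c j) :
    M.det.natDegree + ∑ i, w i ≤ ∑ j, c j ∨ M.det = 0 := by
  classical
  rw [or_iff_not_imp_right]
  intro hdet
  have key : ∀ σ : Equiv.Perm ι, (∏ i, M (σ i) i) ≠ 0 →
      (∏ i, M (σ i) i).natDegree + ∑ i, w i ≤ ∑ j, c j := by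
    intro σ hσ
    rw [Finset.prod_ne_zero_iff] at hσ
    rw [natDegree_prod _ _ hσ, ← Equiv.sum_comp σ w, ← Finset.sum_add_distrib]
    exact Finset.sum_le_sum fun i hi ↦ h _ _ (hσ i hi)
  have hle : ∑ i, w i ≤ ∑ j, c j := by
    by_contra hlt
    apply hdet
    rw [Matrix.det_apply]
    refine Finset.sum_eq_zero fun σ _ ↦ ?_
    have : ∏ i, M (σ i) i = 0 := by
      by_contra h0
      have := key σ h0
      omega
    rw [this, smul_zero]
  rw [← Nat.le_sub_iff_add_le hle, Matrix.det_apply]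
  refine natDegree_sum_le_of_forall_le _ _ fun σ _ ↦ ?_
  rcases eq_or_ne (∏ i, M (σ i) i) 0 with h0 | h0
  · simp [h0]
  · refine (natDegree_smul_le _ _).trans ?_
    have := key σ h0
    omega

theorem sum_range_add_eq (m n : ℕ) :
    (∑ j ∈ Finset.range m, (n + j)) + ∑ j ∈ Finset.range n, (m + j) =
      m * n + ∑ i ∈ Finset.range (m + n), i := by
  induction n with
  | zero => simp
  | succ n ih =>
    have h1 : ∑ j ∈ Finset.range m, (n + 1 + j) = (∑ j ∈ Finset.range m, (n + j)) + m := by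
      rw [Finset.sum_congr rfl fun j _ ↦ add_right_comm n 1 j, Finset.sum_add_distrib]
      simp
    rw [h1, Finset.sum_range_succ, ← add_assoc m n 1, Finset.sum_range_succ]
    linarith

/-- The resultant of two polynomials in two variables of total degrees `m` and `n` has degree at
most `m * n`. -/
theorem natDegree_resultant_le {f g : ℝ[X][X]} {m n : ℕ}
    (hf : ∀ j ≤ m, (f.coeff j).natDegree + j ≤ m) (hg : ∀ j ≤ n, (g.coeff j).natDegree + j ≤ n) :
    (f.resultant g m n).natDegree ≤ m * n := by
  rcases eq_or_ne (f.resultant g m n) 0 with h0 | h0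
  · simp [h0]
  -- The entry in row `i` of the `j`-th column of the `g` block is the coefficient `i - j` of `g`,
  -- of degree at most `n + j - i`; similarly for `f` with `m`.
  let c : Fin (m + n) → ℕ := Fin.addCases (fun j : Fin m ↦ n + j) (fun j : Fin n ↦ m + j)
  have h := natDegree_det_le (sylvester f g m n) c (fun i ↦ i) ?_
  · have h := h.resolve_right h0
    have hc : ∑ j, c j = m * n + ∑ i : Fin (m + n), (i : ℕ) := by
      rw [Fin.sum_univ_add, Fin.sum_univ_eq_sum_range (fun i ↦ i)]
      simp only [c, Fin.addCases_left, Fin.addCases_right]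
      rw [Fin.sum_univ_eq_sum_range (fun j ↦ n + j), Fin.sum_univ_eq_sum_range (fun j ↦ m + j)]
      exact sum_range_add_eq m n
    rw [hc] at h
    exact Nat.le_of_add_le_add_right h
  · intro i j hij
    induction j using Fin.addCases with
    | left j =>
      simp only [sylvester, Matrix.of_apply, Fin.addCases_left, c, Set.mem_Icc] at hij ⊢
      split_ifs at hij ⊢ with h1
      · have := hg (i - j) (by omega)
        omega
      · simp at hij
    | right j =>
      simp only [sylvester, Matrix.of_apply, Fin.addCases_right, c, Set.mem_Icc] at hij ⊢
      split_ifs at hij ⊢ with h1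
      · have := hf (i - j) (by omega)
        omega
      · simp at hij

/-- The resultant of the divided differences of `x` and `y`, whose zeros are the parameter values
of the double points of the plane curve `(x, y)`. -/
def doublePointPoly (m n : ℕ) (x y : ℝ[X]) : ℝ[X] :=
  (divDiffPoly (m + 1) x).resultant (divDiffPoly (n + 1) y) m n

/-- The coefficient of `t ^ j` in the divided difference has had `j + 1` powers divided out, so the
total degrees are at most `m` and `n`. -/
theorem natDegree_doublePointPoly_le {m n : ℕ} {x y : ℝ[X]} (hx : x.natDegree ≤ m + 1)
    (hy : y.natDegree ≤ n + 1) : (doublePointPoly m n x y).natDegree ≤ m * n := by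
  refine natDegree_resultant_le (fun j hj ↦ ?_) (fun j hj ↦ ?_) <;>
  · rw [coeff_divDiffPoly, if_pos (by omega), natDegree_iterate_divX]
    omega

/-- The resultant lies in the ideal generated by the two divided differences, and both vanish at
`(s, t)`. -/
theorem eval_doublePointPoly_eq_zero {m n : ℕ} {x y : ℝ[X]} (hx : x.natDegree ≤ m + 1)
    (hy : y.natDegree ≤ n + 1) (hm : m ≠ 0) {s t : ℝ} (hst : s ≠ t)
    (h1 : x.eval s = x.eval t) (h2 : y.eval s = y.eval t) :
    (doublePointPoly m n x y).eval s = 0 := by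
  obtain ⟨p, q, -, -, h⟩ := exists_mul_add_mul_eq_C_resultant _ _ (natDegree_divDiffPoly_le m x)
    (natDegree_divDiffPoly_le n y) (Or.inl hm)
  have h3 : divDiff (m + 1) x s t = 0 := by
    have := eval_sub_eval_eq hx s t
    rw [h1, sub_self, zero_eq_mul] at this
    exact this.resolve_left (sub_ne_zero.2 hst)
  have h4 : divDiff (n + 1) y s t = 0 := by
    have := eval_sub_eval_eq hy s t
    rw [h2, sub_self, zero_eq_mul] at this
    exact this.resolve_left (sub_ne_zero.2 hst)
  have := congrArg (fun f : ℝ[X][X] ↦ (f.eval (C t)).eval s) h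
  simp only [eval_add, eval_mul, eval_C, eval_eval_divDiffPoly, h3, h4, zero_mul, add_zero] at this
  exact this.symm

/-- At `s = 0` the divided difference of `p` is `p.divX` in the variable `t`. A nonzero value here
certifies that the double point polynomial is not identically zero. -/
theorem eval_zero_doublePointPoly {m n : ℕ} {x y : ℝ[X]} (hx : x.natDegree ≤ m + 1)
    (hy : y.natDegree ≤ n + 1) :
    (doublePointPoly m n x y).eval 0 = x.divX.resultant y.divX m n := by
  rw [doublePointPoly, ← coe_evalRingHom, ← resultant_map_map, map_divDiffPoly_zero hx,
    map_divDiffPoly_zero hy]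

theorem coeff_divX_perturb (p : ℝ[X]) (a b : ℝ) (j : ℕ) : (perturb p a b).divX.coeff j =
    p.coeff (j + 1) + (if j = 0 then a else 0) + if j = 1 then b else 0 := by
  simp [perturb, coeff_X_pow, coeff_C]

theorem natDegree_perturb_le {p : ℝ[X]} {m : ℕ} (hp : p.natDegree ≤ m + 1) (hm : 1 ≤ m)
    (a b : ℝ) : (perturb p a b).natDegree ≤ m + 1 := by
  refine natDegree_add_le_of_degree_le (natDegree_add_le_of_degree_le hp ?_) ?_
  · exact (natDegree_C_mul_le a X).trans (natDegree_X_le.trans (by omega))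
  · exact (natDegree_C_mul_X_pow_le b 2).trans (by omega)

theorem continuous_resultant_perturb (x y : ℝ[X]) (m n : ℕ) :
    Continuous fun p : Params ↦ (perturb x p.1.1 p.2.1).divX.resultant
      (perturb y p.1.2 p.2.2).divX m n := by
  refine Continuous.matrix_det (continuous_matrix fun i j ↦ ?_)
  induction j using Fin.addCases with
  | left j =>
    simp only [sylvester, Matrix.of_apply, Fin.addCases_left, coeff_divX_perturb]
    split_ifs <;> fun_prop
  | right j =>
    simp only [sylvester, Matrix.of_apply, Fin.addCases_right, coeff_divX_perturb]
    split_ifs <;> fun_prop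

theorem exists_small_ne {F : Set ℝ} (hF : F.Finite) {ε : ℝ} (hε : 0 < ε) :
    ∃ a, 0 < a ∧ a < ε ∧ a ∉ F := by
  obtain ⟨a, ha, haF⟩ := (Set.Ioo_infinite hε).exists_notMem_finite hF
  exact ⟨a, ha.1, ha.2, haF⟩

theorem natDegree_divX_perturb {p : ℝ[X]} {m : ℕ} (hp : max p.natDegree 2 = m + 1) {b : ℝ}
    (hb : p.coeff 2 + b ≠ 0) (a : ℝ) : (perturb p a b).divX.natDegree = m := by
  have hm : 1 ≤ m := by have := le_max_right p.natDegree 2; omega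
  refine natDegree_eq_of_le_of_coeff_ne_zero ?_ ?_
  · exact natDegree_divX_le (natDegree_perturb_le ((le_max_left _ _).trans hp.le) hm a b)
  · rw [coeff_divX_perturb]
    rcases eq_or_ne m 1 with rfl | hm1
    · simpa using hb
    · have hd : p.natDegree = m + 1 := by omega
      rw [if_neg (by omega), if_neg hm1, add_zero, add_zero, ← hd]
      exact leadingCoeff_ne_zero.2 (by rintro rfl; simp at hd)

/-- The quadratic terms make the degrees of the quotients exactly `m` and `n`. The linear term then
shifts the first quotient by the constant `a`, and a common complex root must be one of the finitely
many roots of `g`, each of which excludes at most one `a`. -/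
theorem exists_resultant_perturb_ne_zero {x y : ℝ[X]} {m n : ℕ}
    (hm : max x.natDegree 2 = m + 1) (hn : max y.natDegree 2 = n + 1) {ε : ℝ} (hε : 0 < ε) :
    ∃ p : Params, ‖p‖ < ε ∧ (perturb x p.1.1 p.2.1).divX.resultant
      (perturb y p.1.2 p.2.2).divX m n ≠ 0 := by
  classical
  have hn1 : 1 ≤ n := by have := le_max_right y.natDegree 2; omega
  obtain ⟨b, hb0, hbε, hb⟩ := exists_small_ne (Set.finite_singleton (-x.coeff 2)) hε
  obtain ⟨c, hc0, hcε, hc⟩ := exists_small_ne (Set.finite_singleton (-y.coeff 2)) hε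
  have hb' : x.coeff 2 + b ≠ 0 := fun h ↦ hb (by rw [Set.mem_singleton_iff]; linarith)
  have hc' : y.coeff 2 + c ≠ 0 := fun h ↦ hc (by rw [Set.mem_singleton_iff]; linarith)
  set g := (perturb y 0 c).divX with hg
  have hgd : g.natDegree = n := natDegree_divX_perturb hn hc' 0
  have hg0 : g ≠ 0 := by rintro h; rw [h] at hgd; simp at hgd; omega
  have hfin : {τ : ℂ | aeval τ g = 0}.Finite := by
    refine (g.aroots ℂ).toFinset.finite_toSet.subset fun τ hτ ↦ ?_
    simpa [hg0] using hτ
  obtain ⟨a, ha0, haε, ha⟩ := exists_small_ne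
    (hfin.image fun τ ↦ (-aeval τ (perturb x 0 b).divX).re) hε
  refine ⟨((a, 0), (b, c)), ?_, ?_⟩
  · simp [Prod.norm_def, abs_of_pos, ha0, hb0, hc0, haε, hbε, hcε, hε]
  · have hfd : (perturb x a b).divX.natDegree = m := natDegree_divX_perturb hm hb' a
    simp only
    rw [← hg]
    -- The criterion by common roots concerns the resultant formed with the actual degrees.
    nth_rw 1 [← hfd, ← hgd]
    rw [Ne, resultant_eq_zero_iff, not_and_not_right]
    intro _
    rw [isCoprime_iff_aeval_ne_zero_of_isAlgClosed ℝ ℂ]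
    intro τ
    by_contra! hτ
    apply ha
    refine ⟨τ, hτ.2, ?_⟩
    have e : (perturb x a b).divX = (perturb x 0 b).divX + C a := by
      ext j
      rw [coeff_add, coeff_divX_perturb, coeff_divX_perturb, coeff_C]
      split_ifs <;> ring
    have h1 := hτ.1
    rw [e, map_add, aeval_C] at h1
    have h2 : -aeval τ (perturb x 0 b).divX = (a : ℂ) := by
      rw [neg_eq_iff_add_eq_zero]
      exact h1
    simp only [h2, Complex.ofReal_re]

end PolynomialKnots

end

noncomputable section

namespace PolynomialKnots

open Filter Topology

/-! ### Generic perturbations -/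

open MeasureTheory in
/-- Lebesgue measure on the space of parameters. -/
abbrev paramMeasure : Measure Params :=
  ((volume : Measure ℝ).prod volume).prod ((volume : Measure ℝ).prod volume)

open MeasureTheory in
instance : Measure.IsAddHaarMeasure paramMeasure := by
  have : Measure.IsAddHaarMeasure ((volume : Measure ℝ).prod (volume : Measure ℝ)) :=
    Measure.prod.instIsAddHaarMeasure _ _
  exact Measure.prod.instIsAddHaarMeasure _ _

/-- The equidimensional case of Sard's theorem: a direction killed by the derivative makes its
determinant zero. -/
theorem paramMeasure_image_eq_zero {f : Params → Params} {A : Set Params}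
    (hf : ∀ q ∈ A, DifferentiableAt ℝ f q)
    (hker : ∀ q ∈ A, ∃ v : Params, v ≠ 0 ∧ HasDerivAt (fun r : ℝ ↦ f (q + r • v)) 0 0) :
    paramMeasure (f '' A) = 0 := by
  refine MeasureTheory.addHaar_image_eq_zero_of_det_fderivWithin_eq_zero _
    (f' := fun q ↦ fderiv ℝ f q) (fun q hq ↦ (hf q hq).hasFDerivAt.hasFDerivWithinAt) ?_
  intro q hq
  obtain ⟨v, hv, hder⟩ := hker q hq
  rw [ContinuousLinearMap.det, LinearMap.det_eq_zero_iff_ker_ne_bot]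
  intro hbot
  apply hv
  have h1 : HasDerivAt (fun r : ℝ ↦ q + r • v) v 0 := by
    simpa using ((hasDerivAt_id (0 : ℝ)).smul_const v).const_add q
  have h2 : HasFDerivAt f (fderiv ℝ f q) (q + (0 : ℝ) • v) := by
    simpa using (hf q hq).hasFDerivAt
  have h3 := (h2.comp_hasDerivAt (0 : ℝ) h1).unique hder
  have h4 : v ∈ LinearMap.ker ((fderiv ℝ f q : Params →L[ℝ] Params) : Params →ₗ[ℝ] Params) := h3
  rw [hbot] at h4
  exact h4

/-- The coefficient `a` for which the polynomial `perturb p a b` takes equal values at `s`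
and `t`. -/
def slope (p : ℝ[X]) (b s t : ℝ) : ℝ :=
  -((p.eval s + b * s ^ 2 - (p.eval t + b * t ^ 2)) / (s - t))

theorem eq_slope {p : ℝ[X]} {a b s t : ℝ} (hst : s ≠ t)
    (h : (perturb p a b).eval s = (perturb p a b).eval t) : a = slope p b s t := by
  have : s - t ≠ 0 := sub_ne_zero.2 hst
  simp only [eval_perturb] at h
  rw [slope, eq_neg_iff_add_eq_zero]
  field_simp
  linear_combination h

theorem eval_perturb_derivative (p : ℝ[X]) (a b t : ℝ) :
    (perturb p a b).derivative.eval t = p.derivative.eval t + a + 2 * b * t := by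
  simp [perturb]
  ring

/-- With `P` the perturbed polynomial, differentiating `P s = P t` implicitly shows that the slope
varies by `-(P' s * σ - P' t * τ) / (s - t)`. -/
theorem hasDerivAt_slope (p : ℝ[X]) (b : ℝ) {s t σ τ : ℝ} (hst : s ≠ t)
    (h : (perturb p (slope p b s t) b).derivative.eval s * σ =
      (perturb p (slope p b s t) b).derivative.eval t * τ) :
    HasDerivAt (fun r : ℝ ↦ slope p b (s + r * σ) (t + r * τ)) 0 0 := by
  have hne : s - t ≠ 0 := sub_ne_zero.2 hst
  have hline : ∀ c v : ℝ, HasDerivAt (fun r : ℝ ↦ c + r * v) v 0 := fun c v ↦ by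
    simpa using ((hasDerivAt_id (0 : ℝ)).mul_const v).const_add c
  have hev : ∀ c v : ℝ, HasDerivAt (fun r : ℝ ↦ p.eval (c + r * v)) (p.derivative.eval c * v) 0 :=
    fun c v ↦ by
      have : HasDerivAt (fun t ↦ p.eval t) (p.derivative.eval c) (c + 0 * v) := by
        simpa using p.hasDerivAt c
      exact this.comp (0 : ℝ) (hline c v)
  have hsq : ∀ c v : ℝ, HasDerivAt (fun r : ℝ ↦ b * (c + r * v) ^ 2) (b * (2 * c * v)) 0 :=
    fun c v ↦ by simpa using ((hline c v).fun_pow 2).const_mul b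
  have hnum := ((hev s σ).add (hsq s σ)).sub ((hev t τ).add (hsq t τ))
  have hden := (hline s σ).sub (hline t τ)
  have hq := (hnum.div hden (by simpa using hne)).neg
  have hzero : ((p.derivative.eval s * σ + b * (2 * s * σ) - (p.derivative.eval t * τ +
      b * (2 * t * τ))) * (s - t) - (p.eval s + b * s ^ 2 - (p.eval t + b * t ^ 2)) *
        (σ - τ)) = 0 := by
    simp only [eval_perturb_derivative, slope] at h
    field_simp at h
    linear_combination h
  refine hq.congr_deriv ?_
  simp only [Pi.sub_apply, Pi.add_apply, zero_mul, add_zero]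
  rw [hzero, zero_div, neg_zero]

/-- The parameters of the perturbation for which `s` and `t` are the parameter values of a
double point. -/
def doubleParams (x y : ℝ[X]) (q : Params) : Params :=
  ((slope x q.2.1 q.1.1 q.1.2, slope y q.2.2 q.1.1 q.1.2), q.2)

theorem differentiableAt_doubleParams (x y : ℝ[X]) {q : Params} (hq : q.1.1 ≠ q.1.2) :
    DifferentiableAt ℝ (doubleParams x y) q := by
  have hne : q.1.1 - q.1.2 ≠ 0 := sub_ne_zero.2 hq
  have hx : ∀ r, DifferentiableAt ℝ (fun t ↦ x.eval t) r := fun r ↦ x.differentiable r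
  have hy : ∀ r, DifferentiableAt ℝ (fun t ↦ y.eval t) r := fun r ↦ y.differentiable r
  unfold doubleParams slope
  fun_prop (disch := assumption)

theorem exists_kernel_vector {a b c d : ℝ} (h : a * d - b * c = 0) :
    ∃ σ τ : ℝ, (σ ≠ 0 ∨ τ ≠ 0) ∧ a * σ = b * τ ∧ c * σ = d * τ := by
  by_cases h1 : b ≠ 0 ∨ a ≠ 0
  · exact ⟨b, a, h1, by ring, by linarith⟩
  · push Not at h1
    by_cases h2 : d ≠ 0 ∨ c ≠ 0
    · exact ⟨d, c, h2, by simp [h1], by ring⟩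
    · push Not at h2
      exact ⟨1, 0, by simp, by simp [h1], by simp [h2]⟩

/-- Nontransverse double points come from critical points of `doubleParams`: when the tangents at
`s` and `t` are dependent, one vector `(σ, τ)` leaves both slopes stationary. -/
theorem null_nontransverse (x y : ℝ[X]) : paramMeasure (doubleParams x y '' {q | q.1.1 ≠ q.1.2 ∧
    (perturb x (slope x q.2.1 q.1.1 q.1.2) q.2.1).derivative.eval q.1.1 *
      (perturb y (slope y q.2.2 q.1.1 q.1.2) q.2.2).derivative.eval q.1.2 -
    (perturb x (slope x q.2.1 q.1.1 q.1.2) q.2.1).derivative.eval q.1.2 *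
      (perturb y (slope y q.2.2 q.1.1 q.1.2) q.2.2).derivative.eval q.1.1 = 0}) = 0 := by
  refine paramMeasure_image_eq_zero (fun q hq ↦ differentiableAt_doubleParams x y hq.1) ?_
  rintro ⟨⟨s, t⟩, ⟨α, β⟩⟩ ⟨hst, h⟩
  obtain ⟨σ, τ, hne, h1, h2⟩ := exists_kernel_vector h
  refine ⟨((σ, τ), (0, 0)), fun h0 ↦ ?_, ?_⟩
  · rw [Prod.mk_eq_zero, Prod.mk_eq_zero] at h0
    rcases hne with h | h
    · exact h h0.1.1
    · exact h h0.1.2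
  · have := ((hasDerivAt_slope x α hst h1).prodMk (hasDerivAt_slope y β hst h2)).prodMk
      (hasDerivAt_const (0 : ℝ) ((α, β) : ℝ × ℝ))
    have e : (fun r : ℝ ↦ doubleParams x y (((s, t), (α, β)) + r • ((σ, τ), (0, 0)))) =
        fun r : ℝ ↦ ((slope x α (s + r * σ) (t + r * τ), slope y β (s + r * σ) (t + r * τ)),
          (α, β)) := by
      ext r <;> simp [doubleParams]
    rw [e]
    exact this

/-- Here the source is already null: each slice of `z s = z t` is finite, and differentiable maps
preserve null sets. Avoiding this image keeps the perturbed space curve injective. -/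
theorem null_eq_height (x y : ℝ[X]) {z : ℝ[X]} (hz : 0 < z.natDegree) :
    paramMeasure (doubleParams x y '' {q | q.1.1 ≠ q.1.2 ∧ z.eval q.1.1 = z.eval q.1.2}) = 0 := by
  refine MeasureTheory.addHaar_image_eq_zero_of_differentiableOn_of_addHaar_eq_zero _
    (fun q hq ↦ (differentiableAt_doubleParams x y hq.1).differentiableWithinAt) ?_
  have h1 : (MeasureTheory.volume.prod MeasureTheory.volume)
      {r : ℝ × ℝ | z.eval r.1 = z.eval r.2} = 0 := by
    rw [MeasureTheory.Measure.measure_prod_null]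
    · refine Eventually.of_forall fun s ↦ ?_
      have hfin : {t : ℝ | z.eval s = z.eval t}.Finite := by
        have h0 : z - C (z.eval s) ≠ 0 := by
          intro h
          rw [sub_eq_zero] at h
          rw [h, natDegree_C] at hz
          exact lt_irrefl _ hz
        refine (z - C (z.eval s)).roots.toFinset.finite_toSet.subset fun t ht ↦ ?_
        have ht : z.eval s = z.eval t := ht
        rw [Finset.mem_coe, Multiset.mem_toFinset, mem_roots h0]
        simp [ht]
      exact hfin.measure_zero _
    · exact (isClosed_eq (by fun_prop) (by fun_prop)).measurableSet
  refine MeasureTheory.measure_mono_null (t := {r : ℝ × ℝ | z.eval r.1 = z.eval r.2} ×ˢ Set.univ)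
    (fun q hq ↦ ⟨hq.2, trivial⟩) ?_
  rw [MeasureTheory.Measure.prod_prod, h1, zero_mul]

/-- The coefficient `b` for which some polynomial `perturb p a b` takes equal values at `s`, `t`
and `u`. -/
def curvature (p : ℝ[X]) (s t u : ℝ) : ℝ :=
  -(((p.eval s - p.eval t) / (s - t) - (p.eval s - p.eval u) / (s - u)) / (t - u))

theorem eq_curvature {p : ℝ[X]} {a b s t u : ℝ} (hst : s ≠ t) (hsu : s ≠ u) (htu : t ≠ u)
    (h1 : (perturb p a b).eval s = (perturb p a b).eval t)
    (h2 : (perturb p a b).eval s = (perturb p a b).eval u) : b = curvature p s t u := by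
  have h3 : s - t ≠ 0 := sub_ne_zero.2 hst
  have h4 : s - u ≠ 0 := sub_ne_zero.2 hsu
  have h5 : t - u ≠ 0 := sub_ne_zero.2 htu
  simp only [eval_perturb] at h1 h2
  rw [curvature, eq_neg_iff_add_eq_zero]
  field_simp
  linear_combination (s - u) * h1 - (s - t) * h2

/-- The parameters of the perturbation for which `s`, `t` and `u` are the parameter values of a
triple point. -/
def tripleParams (x y : ℝ[X]) (q : Params) : Params :=
  doubleParams x y (q.1, (curvature x q.1.1 q.1.2 q.2.1, curvature y q.1.1 q.1.2 q.2.1))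

/-- Triple points form a three-parameter family in a four-dimensional space: `tripleParams` ignores
its last coordinate, which supplies the kernel direction. -/
theorem null_triple (x y : ℝ[X]) : paramMeasure (tripleParams x y ''
    {q | q.1.1 ≠ q.1.2 ∧ q.1.1 ≠ q.2.1 ∧ q.1.2 ≠ q.2.1}) = 0 := by
  refine paramMeasure_image_eq_zero ?_ ?_
  · rintro q ⟨h1, h2, h3⟩
    have hx : ∀ r, DifferentiableAt ℝ (fun t ↦ x.eval t) r := fun r ↦ x.differentiable r
    have hy : ∀ r, DifferentiableAt ℝ (fun t ↦ y.eval t) r := fun r ↦ y.differentiable r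
    have h4 : q.1.1 - q.1.2 ≠ 0 := sub_ne_zero.2 h1
    have h5 : q.1.1 - q.2.1 ≠ 0 := sub_ne_zero.2 h2
    have h6 : q.1.2 - q.2.1 ≠ 0 := sub_ne_zero.2 h3
    unfold tripleParams
    refine DifferentiableAt.comp q (g := doubleParams x y) (differentiableAt_doubleParams x y h1) ?_
    unfold curvature
    fun_prop (disch := assumption)
  · rintro q -
    refine ⟨(0, (0, 1)), by simp, ?_⟩
    have e : (fun r : ℝ ↦ tripleParams x y (q + r • ((0 : ℝ × ℝ), ((0 : ℝ), (1 : ℝ))))) =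
        fun _ ↦ tripleParams x y q := by
      funext r
      simp [tripleParams]
    rw [e]
    exact hasDerivAt_const _ _

/-- Arbitrarily small perturbations of a plane curve have only transverse double points, at
which the height function `z` takes different values, and the number of their parameter values is
bounded by Bézout. -/
theorem exists_generic_perturb (x y : ℝ[X]) {z : ℝ[X]} (hz : 0 < z.natDegree) {m n : ℕ}
    (hm : max x.natDegree 2 = m + 1) (hn : max y.natDegree 2 = n + 1) {U : Set Params}
    (hU : U ∈ 𝓝 0) : ∃ p ∈ U,
      Function.Injective (polyCurve (perturb x p.1.1 p.2.1) (perturb y p.1.2 p.2.2) z) ∧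
      0 < (perturb x p.1.1 p.2.1).natDegree ∧ ∃ S : Finset ℝ, S.card ≤ m * n ∧
        IsRegularPlaneCurve (perturb x p.1.1 p.2.1) (perturb y p.1.2 p.2.2) S := by
  classical
  have hm1 : 1 ≤ m := by have := le_max_right x.natDegree 2; omega
  have hn1 : 1 ≤ n := by have := le_max_right y.natDegree 2; omega
  have hxd : ∀ a b, (perturb x a b).natDegree ≤ m + 1 :=
    natDegree_perturb_le ((le_max_left _ _).trans hm.le) hm1
  have hyd : ∀ a b, (perturb y a b).natDegree ≤ n + 1 :=
    natDegree_perturb_le ((le_max_left _ _).trans hn.le) hn1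
  obtain ⟨ε, hε, hεU⟩ := Metric.mem_nhds_iff.1 hU
  obtain ⟨p₀, hp₀, hres₀⟩ := exists_resultant_perturb_ne_zero hm hn hε
  -- Nonvanishing of the resultant is an open condition, so `O` has positive measure and cannot lie
  -- in the null set of bad parameters.
  set O : Set Params := Metric.ball 0 ε ∩ {p | (perturb x p.1.1 p.2.1).divX.resultant
      (perturb y p.1.2 p.2.2).divX m n ≠ 0} with hO
  have hOopen : IsOpen O := Metric.isOpen_ball.inter
    (isOpen_ne_fun (continuous_resultant_perturb x y m n) continuous_const)
  have hOne : O.Nonempty := ⟨p₀, by simpa using hp₀, hres₀⟩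
  have hnull := MeasureTheory.measure_union_null (null_nontransverse x y)
    (MeasureTheory.measure_union_null (null_eq_height x y hz) (null_triple x y))
  obtain ⟨p, hpO, hp⟩ : (O \ _).Nonempty := by
    rw [Set.sdiff_nonempty]
    intro hsub
    exact (hOopen.measure_pos paramMeasure hOne).ne' (MeasureTheory.measure_mono_null hsub hnull)
  simp only [Set.mem_union, not_or] at hp
  obtain ⟨hp1, hp2, hp3⟩ := hp
  have hdouble : ∀ s t, s ≠ t → (perturb x p.1.1 p.2.1).eval s = (perturb x p.1.1 p.2.1).eval t →
      (perturb y p.1.2 p.2.2).eval s = (perturb y p.1.2 p.2.2).eval t →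
      p.1.1 = slope x p.2.1 s t ∧ p.1.2 = slope y p.2.2 s t :=
    fun s t hst h1 h2 ↦ ⟨eq_slope hst h1, eq_slope hst h2⟩
  have hR : doublePointPoly m n (perturb x p.1.1 p.2.1) (perturb y p.1.2 p.2.2) ≠ 0 := by
    intro h0
    have := eval_zero_doublePointPoly (hxd p.1.1 p.2.1) (hyd p.1.2 p.2.2)
    rw [h0, eval_zero] at this
    exact hpO.2 this.symm
  refine ⟨p, hεU hpO.1, ?_, ?_,
    (doublePointPoly m n (perturb x p.1.1 p.2.1) (perturb y p.1.2 p.2.2)).roots.toFinset,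
    ?_, ?_, ?_, ?_⟩
  · intro s t hst
    by_contra hne
    have h1 := congrArg (fun v : V ↦ v.1.re) hst
    have h2 := congrArg (fun v : V ↦ v.1.im) hst
    have h3 := congrArg (fun v : V ↦ v.2) hst
    obtain ⟨h4, h5⟩ := hdouble s t hne h1 h2
    exact hp2 ⟨((s, t), p.2), ⟨hne, h3⟩, Prod.ext (Prod.ext h4.symm h5.symm) rfl⟩
  · by_contra h0
    have h0 : (perturb x p.1.1 p.2.1).natDegree = 0 := by omega
    apply hpO.2
    have : (perturb x p.1.1 p.2.1).divX = 0 := by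
      rw [eq_C_of_natDegree_eq_zero h0, divX_C]
    rw [this, resultant_zero_left, zero_pow (by omega), zero_mul]
  · exact (Multiset.toFinset_card_le _).trans ((card_roots' _).trans
      (natDegree_doublePointPoly_le (hxd _ _) (hyd _ _)))
  · intro s t hst h1 h2 h3
    obtain ⟨h4, h5⟩ := hdouble s t hst h1 h2
    refine hp1 ⟨((s, t), p.2), ⟨hst, ?_⟩, Prod.ext (Prod.ext h4.symm h5.symm) rfl⟩
    simp only
    rw [← h4, ← h5]
    exact h3
  · intro s t u h1 h2 h3 h4
    by_contra! hne
    obtain ⟨hst, hsu, htu⟩ := hne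
    obtain ⟨h5, h6⟩ := hdouble s t hst h1 h2
    have h7 := eq_curvature hst hsu htu h1 h3
    have h8 := eq_curvature hst hsu htu h2 h4
    refine hp3 ⟨((s, t), (u, 0)), ⟨hst, hsu, htu⟩, ?_⟩
    simp only [tripleParams, doubleParams]
    rw [← h7, ← h8, ← h5, ← h6]
  · intro s t hst h1 h2
    rw [Multiset.mem_toFinset, mem_roots hR]
    exact eval_doublePointPoly_eq_zero (hxd _ _) (hyd _ _) (by omega) hst h1 h2

end PolynomialKnots

end

noncomputable section

namespace PolynomialKnots

open Filter Topology

/-! ### Normal forms of polynomial knots -/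

theorem natDegree_sub_le_of_natDegree_le {p q : ℝ[X]} {d : ℕ} (hp : p.natDegree ≤ d)
    (hq : q.natDegree ≤ d) : (p - q).natDegree ≤ d :=
  (natDegree_sub_le_of_le hp hq).trans (max_self d).le

theorem IsKnotCurve.of_linear {x y z x' y' z' : ℝ[X]} (h : IsKnotCurve x y z)
    (hiso : AmbientIsotopic (polyCurve x y z) (polyCurve x' y' z'))
    (hlin : ∀ t, x'.derivative.eval t = 0 → y'.derivative.eval t = 0 → z'.derivative.eval t = 0 →
      x.derivative.eval t = 0 ∧ y.derivative.eval t = 0 ∧ z.derivative.eval t = 0) :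
    IsKnotCurve x' y' z' :=
  ⟨hiso.injective h.injective, fun t ht ↦ h.immersion t (hlin t ht.1 ht.2.1 ht.2.2)⟩

/-- Subtracting multiples of `z` from `x` and `y`. -/
theorem IsKnotCurve.sub_mul_height {x y z : ℝ[X]} (h : IsKnotCurve x y z) (a b : ℝ) :
    IsKnotCurve (x - C a * z) (y - C b * z) z ∧
      AmbientIsotopic (polyCurve x y z) (polyCurve (x - C a * z) (y - C b * z) z) := by
  have hiso : AmbientIsotopic (polyCurve x y z) (polyCurve (x - C a * z) (y - C b * z) z) := by
    convert AmbientIsotopic.translate (polyCurve x y z) (c := fun ζ ↦ (⟨a, b⟩ : ℂ) * (ζ : ℂ))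
      (by fun_prop) using 2 with t
    refine Prod.ext (Complex.ext ?_ ?_) rfl <;> simp [polyCurve]
  refine ⟨h.of_linear hiso fun t h1 h2 h3 ↦ ?_, hiso⟩
  simp only [derivative_sub, derivative_C_mul, eval_sub, eval_mul, eval_C, h3, mul_zero,
    sub_zero] at h1 h2
  exact ⟨h1, h2, h3⟩

/-- Adding multiples of `x` and `y` to `z`. -/
theorem IsKnotCurve.add_mul_plane {x y z : ℝ[X]} (h : IsKnotCurve x y z) (a b : ℝ) :
    IsKnotCurve x y (z + C a * x + C b * y) ∧
      AmbientIsotopic (polyCurve x y z) (polyCurve x y (z + C a * x + C b * y)) := by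
  have hiso : AmbientIsotopic (polyCurve x y z) (polyCurve x y (z + C a * x + C b * y)) := by
    convert AmbientIsotopic.vertical (polyCurve x y z) (μ := fun _ ↦ 1)
      (ν := fun w ↦ a * w.re + b * w.im) continuous_const
      (by have := Complex.continuous_re; have := Complex.continuous_im; fun_prop)
      (fun _ ↦ one_pos) using 2 with t
    refine Prod.ext rfl ?_
    simp [polyCurve, add_assoc]
  refine ⟨h.of_linear hiso fun t h1 h2 h3 ↦ ?_, hiso⟩
  simp only [derivative_add, derivative_C_mul, eval_add, eval_mul, eval_C, h1, h2, mul_zero,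
    add_zero] at h3
  exact ⟨h1, h2, h3⟩

/-- Rotating and stretching the plane. -/
theorem IsKnotCurve.rotate {x y z : ℝ[X]} (h : IsKnotCurve x y z) {a b : ℝ}
    (hab : a ^ 2 + b ^ 2 ≠ 0) :
    IsKnotCurve (C b * x - C a * y) (C a * x + C b * y) z ∧
      AmbientIsotopic (polyCurve x y z)
        (polyCurve (C b * x - C a * y) (C a * x + C b * y) z) := by
  have hu : (⟨b, a⟩ : ℂ) ≠ 0 := by
    intro h0
    apply hab
    have h1 := congrArg Complex.re h0
    have h2 := congrArg Complex.im h0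
    simp only [Complex.zero_re, Complex.zero_im] at h1 h2
    rw [h1, h2]
    norm_num
  have hiso : AmbientIsotopic (polyCurve x y z)
      (polyCurve (C b * x - C a * y) (C a * x + C b * y) z) := by
    convert AmbientIsotopic.mul_const (polyCurve x y z) hu using 2 with t
    refine Prod.ext (Complex.ext ?_ ?_) rfl <;> simp [polyCurve] <;> ring
  refine ⟨h.of_linear hiso fun t h1 h2 h3 ↦ ⟨?_, ?_, h3⟩, hiso⟩
  · simp only [derivative_sub, derivative_add, derivative_C_mul, eval_sub, eval_add, eval_mul,
      eval_C] at h1 h2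
    exact (mul_eq_zero.1 (show (a ^ 2 + b ^ 2) * x.derivative.eval t = 0 by
      linear_combination b * h1 + a * h2)).resolve_left hab
  · simp only [derivative_sub, derivative_add, derivative_C_mul, eval_sub, eval_add, eval_mul,
      eval_C] at h1 h2
    exact (mul_eq_zero.1 (show (a ^ 2 + b ^ 2) * y.derivative.eval t = 0 by
      linear_combination b * h2 - a * h1)).resolve_left hab

theorem natDegree_C_mul_le_of_le {p : ℝ[X]} {d : ℕ} (hp : p.natDegree ≤ d) (a : ℝ) :
    (C a * p).natDegree ≤ d := (natDegree_C_mul_le a p).trans hp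

/-- If only `z` has degree `d`, a multiple of it is sheared into `x`. A nonzero planar coefficient
later allows the leading coefficient of `z` to be made positive without a reflection, which would
reverse orientation. -/
theorem IsKnotCurve.exists_coeff_plane_ne_zero {x y z : ℝ[X]} (h : IsKnotCurve x y z) {d : ℕ}
    (hx : x.natDegree ≤ d) (hy : y.natDegree ≤ d) (hz : z.natDegree ≤ d)
    (hne : x.coeff d ≠ 0 ∨ y.coeff d ≠ 0 ∨ z.coeff d ≠ 0) :
    ∃ x' y' z' : ℝ[X], IsKnotCurve x' y' z' ∧
      AmbientIsotopic (polyCurve x y z) (polyCurve x' y' z') ∧ x'.natDegree ≤ d ∧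
      y'.natDegree ≤ d ∧ z'.natDegree ≤ d ∧ x'.coeff d ^ 2 + y'.coeff d ^ 2 ≠ 0 := by
  obtain ⟨a, ha⟩ : ∃ a : ℝ, (x.coeff d - a * z.coeff d) ^ 2 + y.coeff d ^ 2 ≠ 0 := by
    by_cases hxy : x.coeff d ^ 2 + y.coeff d ^ 2 = 0
    · have h1 : x.coeff d = 0 := by nlinarith [sq_nonneg (x.coeff d), sq_nonneg (y.coeff d)]
      have h2 : y.coeff d = 0 := by nlinarith [sq_nonneg (x.coeff d), sq_nonneg (y.coeff d)]
      exact ⟨1, by simpa [h1, h2] using hne⟩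
    · exact ⟨0, by simpa using hxy⟩
  obtain ⟨h1, h2⟩ := h.sub_mul_height a 0
  refine ⟨_, _, _, h1, h2, natDegree_sub_le_of_natDegree_le hx (natDegree_C_mul_le_of_le hz a),
    natDegree_sub_le_of_natDegree_le hy (natDegree_C_mul_le_of_le hz 0), hz, ?_⟩
  simpa using ha

theorem natDegree_le_sub_one {p : ℝ[X]} {d : ℕ} (hp : p.natDegree ≤ d) (h : p.coeff d = 0) :
    p.natDegree ≤ d - 1 := by
  rw [natDegree_le_iff_coeff_eq_zero] at hp ⊢
  intro N hN
  rcases eq_or_ne N d with rfl | hNd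
  · exact h
  · exact hp N (by omega)

/-- Adding multiples of `x` and `y` makes `z` monic of degree `d`. Subtracting multiples of `z` then
removes the degree `d` terms of `x` and `y`, and a rotation with scaling of the plane removes the
degree `d - 1` term of `x`. -/
theorem IsKnotCurve.exists_normal_form {x y z : ℝ[X]} (h : IsKnotCurve x y z) {d : ℕ}
    (hd : 0 < d) (hx : x.natDegree ≤ d) (hy : y.natDegree ≤ d) (hz : z.natDegree ≤ d)
    (hne : x.coeff d ≠ 0 ∨ y.coeff d ≠ 0 ∨ z.coeff d ≠ 0) :
    ∃ x' y' z' : ℝ[X], IsKnotCurve x' y' z' ∧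
      AmbientIsotopic (polyCurve x y z) (polyCurve x' y' z') ∧ x'.natDegree ≤ d - 2 ∧
      y'.natDegree ≤ d - 1 ∧ 0 < z'.natDegree ∧ 0 < z'.leadingCoeff := by
  obtain ⟨x₁, y₁, z₁, h₁, i₁, hx₁, hy₁, hz₁, hne₁⟩ := h.exists_coeff_plane_ne_zero hx hy hz hne
  -- `M` solves the linear equation that makes the new coefficient of degree `d` equal to `1`.
  set M : ℝ := (1 - z₁.coeff d) / (x₁.coeff d ^ 2 + y₁.coeff d ^ 2) with hM
  obtain ⟨h₂, i₂⟩ := h₁.add_mul_plane (M * x₁.coeff d) (M * y₁.coeff d)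
  set z₂ := z₁ + C (M * x₁.coeff d) * x₁ + C (M * y₁.coeff d) * y₁ with hz₂
  have hz₂d : z₂.natDegree ≤ d := natDegree_add_le_of_degree_le (natDegree_add_le_of_degree_le hz₁
    (natDegree_C_mul_le_of_le hx₁ _)) (natDegree_C_mul_le_of_le hy₁ _)
  have hz₂c : z₂.coeff d = 1 := by
    simp only [hz₂, coeff_add, coeff_C_mul]
    have : M * (x₁.coeff d ^ 2 + y₁.coeff d ^ 2) = 1 - z₁.coeff d := by
      rw [hM]; field_simp
    linear_combination this
  have hz₂n : z₂.natDegree = d :=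
    natDegree_eq_of_le_of_coeff_ne_zero hz₂d (by rw [hz₂c]; exact one_ne_zero)
  have hz₂l : 0 < z₂.leadingCoeff := by
    rw [leadingCoeff, hz₂n, hz₂c]
    exact one_pos
  obtain ⟨h₃, i₃⟩ := h₂.sub_mul_height (x₁.coeff d) (y₁.coeff d)
  set x₃ := x₁ - C (x₁.coeff d) * z₂ with hx₃
  set y₃ := y₁ - C (y₁.coeff d) * z₂ with hy₃
  have hx₃d : x₃.natDegree ≤ d - 1 := natDegree_le_sub_one
    (natDegree_sub_le_of_natDegree_le hx₁ (natDegree_C_mul_le_of_le hz₂d _)) (by simp [hx₃, hz₂c])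
  have hy₃d : y₃.natDegree ≤ d - 1 := natDegree_le_sub_one
    (natDegree_sub_le_of_natDegree_le hy₁ (natDegree_C_mul_le_of_le hz₂d _)) (by simp [hy₃, hz₂c])
  by_cases hab : x₃.coeff (d - 1) ^ 2 + y₃.coeff (d - 1) ^ 2 = 0
  · have hc : x₃.coeff (d - 1) = 0 := by
      nlinarith [sq_nonneg (x₃.coeff (d - 1)), sq_nonneg (y₃.coeff (d - 1))]
    exact ⟨x₃, y₃, z₂, h₃, (i₁.trans i₂).trans i₃, natDegree_le_sub_one hx₃d hc, hy₃d,
      hz₂n ▸ hd, hz₂l⟩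
  -- If `a` and `b` are the coefficients of degree `d - 1`, multiplication by `b + i a` sends `a + i
  -- b` to a purely imaginary number.
  · obtain ⟨h₄, i₄⟩ := h₃.rotate hab
    refine ⟨_, _, z₂, h₄, ((i₁.trans i₂).trans i₃).trans i₄, natDegree_le_sub_one (d := d - 1)
      (natDegree_sub_le_of_natDegree_le (natDegree_C_mul_le_of_le hx₃d _)
        (natDegree_C_mul_le_of_le hy₃d _)) ?_,
      natDegree_add_le_of_degree_le (natDegree_C_mul_le_of_le hx₃d _)
        (natDegree_C_mul_le_of_le hy₃d _), hz₂n ▸ hd, hz₂l⟩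
    simp only [coeff_sub, coeff_C_mul]
    ring

/-! ### The bound on the crossing number -/

/-- For `d ≥ 4` the quadratic perturbation respects the bounds `d - 2` and `d - 1`, so the divided
differences have total degrees at most `d - 3` and `d - 2`. -/
theorem IsKnotCurve.exists_crossingNumber_le {x y z : ℝ[X]} (h : IsKnotCurve x y z) {d : ℕ}
    (hd : 4 ≤ d) (hx : x.natDegree ≤ d - 2) (hy : y.natDegree ≤ d - 1) (hz : 0 < z.natDegree)
    (hl : 0 < z.leadingCoeff) {k : ℝ → V} (hk : AmbientIsotopic k (polyCurve x y z))
    (hkinj : Function.Injective k) :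
    ∃ c : ℕ, crossingNumber (OnePoint.map (coords.symm ∘ k)) ≤ c ∧
      2 * c ≤ (d - 3) * (d - 2) := by
  obtain ⟨m, hm⟩ : ∃ m, max x.natDegree 2 = m + 1 :=
    ⟨max x.natDegree 2 - 1, by have := le_max_right x.natDegree 2; omega⟩
  obtain ⟨n, hn⟩ : ∃ n, max y.natDegree 2 = n + 1 :=
    ⟨max y.natDegree 2 - 1, by have := le_max_right y.natDegree 2; omega⟩
  obtain ⟨p, hpU, hinj, hpd, S, hS, hreg⟩ := exists_generic_perturb x y hz hm hn
    (eventually_ambientIsotopic_perturb h hz hl)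
  obtain ⟨c, hc, hcS⟩ :=
    crossingNumber_le_of_isRegularPlaneCurve (hk.trans (hpU hinj)) hkinj hpd hreg
  exact ⟨c, hc, hcS.trans (hS.trans (Nat.mul_le_mul (by omega) (by omega)))⟩

/-- After a small change of its linear coefficient, `x` is an injective affine function, so the
projection has no double points at all. -/
theorem IsKnotCurve.crossingNumber_eq_zero {x y z : ℝ[X]} (h : IsKnotCurve x y z)
    (hx : x.natDegree ≤ 1) (hz : 0 < z.natDegree) (hl : 0 < z.leadingCoeff) {k : ℝ → V}
    (hk : AmbientIsotopic k (polyCurve x y z)) (hkinj : Function.Injective k) :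
    crossingNumber (OnePoint.map (coords.symm ∘ k)) = 0 := by
  obtain ⟨ε, hε, hεU⟩ := Metric.mem_nhds_iff.1 (eventually_ambientIsotopic_perturb h hz hl)
  obtain ⟨a, ha0, haε, ha⟩ := exists_small_ne (Set.finite_singleton (-x.coeff 1)) hε
  have hpU := hεU (show (((a, 0), (0, 0)) : Params) ∈ Metric.ball 0 ε by
    simp [Prod.norm_def, abs_of_pos, ha0, haε, hε])
  simp only [Set.mem_ofPred_eq] at hpU
  have ha' : x.coeff 1 + a ≠ 0 := fun h ↦ ha (by rw [Set.mem_singleton_iff]; linarith)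
  have heval : ∀ t, (perturb x a 0).eval t = x.coeff 0 + (x.coeff 1 + a) * t := by
    intro t
    rw [eval_perturb]
    conv_lhs => rw [eq_X_add_C_of_natDegree_le_one hx]
    simp
    ring
  have hxinj : ∀ s t, (perturb x a 0).eval s = (perturb x a 0).eval t → s = t := by
    intro s t hst
    rw [heval, heval] at hst
    exact mul_left_cancel₀ ha' (add_left_cancel hst)
  have hdeg : 0 < (perturb x a 0).natDegree := by
    by_contra h0
    have h0 : (perturb x a 0).natDegree = 0 := by omega
    have := hxinj 0 1 (by rw [eq_C_of_natDegree_eq_zero h0]; simp)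
    exact zero_ne_one this
  have hiso := hpU fun s t hst ↦ hxinj s t (congrArg (fun v : V ↦ v.1.re) hst)
  obtain ⟨c, hc, hcS⟩ := crossingNumber_le_of_isRegularPlaneCurve (S := ∅) (hk.trans hiso) hkinj
    hdeg ⟨fun s t hst h1 _ ↦ absurd (hxinj s t h1) hst, fun s t u h1 _ _ _ ↦ Or.inl (hxinj s t h1),
      fun s t hst h1 _ ↦ absurd (hxinj s t h1) hst⟩
  obtain rfl : c = 0 := by simpa using hcS
  simpa using hc

theorem completion_eq (κ : Fin 3 → ℝ[X]) :
    completion κ = OnePoint.map (coords.symm ∘ polyCurve (κ 0) (κ 1) (κ 2)) := by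
  unfold completion
  congr 1
  ext t i
  fin_cases i <;> rfl

theorem IsPolynomialKnot.isKnotCurve {κ : Fin 3 → ℝ[X]} (h : IsPolynomialKnot κ) :
    IsKnotCurve (κ 0) (κ 1) (κ 2) := by
  have hcurve : ∀ t, curve κ t = coords.symm (polyCurve (κ 0) (κ 1) (κ 2) t) := by
    intro t
    ext i
    fin_cases i <;> rfl
  refine ⟨fun s t hst ↦ h.injective (by rw [hcurve, hcurve, hst]), fun t ht ↦ h.immersion t ?_⟩
  have h1 : HasDerivAt (fun t i ↦ (κ i).eval t) (fun i ↦ (κ i).derivative.eval t) t :=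
    hasDerivAt_pi.2 fun i ↦ (κ i).hasDerivAt t
  have h2 : HasDerivAt (curve κ) (WithLp.toLp 2 fun i ↦ (κ i).derivative.eval t) t :=
    (PiLp.continuousLinearEquiv 2 ℝ fun _ : Fin 3 ↦ ℝ).symm.hasFDerivAt.comp_hasDerivAt t h1
  rw [h2.deriv]
  ext i
  fin_cases i
  · exact ht.1
  · exact ht.2.1
  · exact ht.2.2

theorem coeff_degree_ne_zero {κ : Fin 3 → ℝ[X]} (hd : 0 < degree κ) :
    (κ 0).coeff (degree κ) ≠ 0 ∨ (κ 1).coeff (degree κ) ≠ 0 ∨ (κ 2).coeff (degree κ) ≠ 0 := by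
  obtain ⟨i, -, hi⟩ := Finset.exists_mem_eq_sup Finset.univ Finset.univ_nonempty
    fun i ↦ (κ i).natDegree
  have hi : degree κ = (κ i).natDegree := hi
  have : (κ i).coeff (degree κ) ≠ 0 := by
    rw [hi] at hd ⊢
    exact leadingCoeff_ne_zero.2 (by intro h0; rw [h0] at hd; simp at hd)
  fin_cases i
  · exact Or.inl this
  · exact Or.inr (Or.inl this)
  · exact Or.inr (Or.inr this)

theorem IsPolynomialKnot.degree_pos {κ : Fin 3 → ℝ[X]} (h : IsPolynomialKnot κ) :
    0 < degree κ := by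
  by_contra h0
  have hconst : ∀ i, (κ i).natDegree = 0 := fun i ↦ by
    have : (κ i).natDegree ≤ degree κ := Finset.le_sup (f := fun i ↦ (κ i).natDegree)
      (Finset.mem_univ i)
    omega
  have : curve κ 0 = curve κ 1 := by
    ext i
    simp only [curve]
    rw [eq_C_of_natDegree_eq_zero (hconst i)]
    simp
  exact zero_ne_one (h.injective this)

end PolynomialKnots

end

theorem mainTheorem6 (κ : Fin 3 → Polynomial ℝ) (hκ : PolynomialKnots.IsPolynomialKnot κ) :
    ∃ c : ℕ, PolynomialKnots.crossingNumber (PolynomialKnots.completion κ) = (c : ℕ∞) ∧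
      (c : ℝ) ≤ 1 / 2 * ((PolynomialKnots.degree κ : ℝ) - 2) *
        ((PolynomialKnots.degree κ : ℝ) - 3) := by
  set d := PolynomialKnots.degree κ with hd
  have hle : ∀ i, (κ i).natDegree ≤ d := fun i ↦
    Finset.le_sup (f := fun i ↦ (κ i).natDegree) (Finset.mem_univ i)
  have hpos : 0 < d := hκ.degree_pos
  have hk := hκ.isKnotCurve
  obtain ⟨x, y, z, h, hiso, hx, hy, hz, hl⟩ := hk.exists_normal_form hpos (hle 0) (hle 1) (hle 2)
    (PolynomialKnots.coeff_degree_ne_zero hpos)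
  rw [PolynomialKnots.completion_eq]
  rcases le_or_gt d 3 with hd3 | hd4
  · refine ⟨0, h.crossingNumber_eq_zero (by omega) hz hl hiso hk.injective, ?_⟩
    -- The bound equals `1`, `0`, `0` in these three cases, so zero crossings suffice.
    have : d = 1 ∨ d = 2 ∨ d = 3 := by omega
    rcases this with h | h | h <;> rw [h] <;> norm_num
  · obtain ⟨c, hc, hcd⟩ := h.exists_crossingNumber_le hd4 hx hy hz hl hiso hk.injective
    obtain ⟨e, he⟩ := ENat.ne_top_iff_exists.1 (ne_top_of_le_ne_top (ENat.natCast_ne_top c) hc)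
    rw [← he] at hc ⊢
    refine ⟨e, rfl, ?_⟩
    have hec : e ≤ c := by exact_mod_cast hc
    have h2 : 2 * e ≤ (d - 3) * (d - 2) := by omega
    have h3 : (2 * e : ℝ) ≤ ((d : ℝ) - 3) * ((d : ℝ) - 2) := by
      have : ((2 * e : ℕ) : ℝ) ≤ (((d - 3) * (d - 2) : ℕ) : ℝ) := by exact_mod_cast h2
      rw [Nat.cast_mul, Nat.cast_mul, Nat.cast_sub (by omega), Nat.cast_sub (by omega)] at this
      exact_mod_cast this
    linarith
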